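/- Let $d\ge 1$, let $\Omega\subseteq\mathbb R^d$ be open with finite volume, and let $W(u)=u^2+W_{conc}(u)$, where $W_{conc}:\mathbb R\to\mathbb R$ is concave and $C^1$, $W\ge 0$ and $W(1)=W(-1)=0$. Let $V$ be an open set with $C^2$ boundary such that $\overline V$ is compact and $\overline V\subset\Omega$, and set $u_0=\chi_V-\chi_{V^c}$. Let $\varepsilon,\tau>0$ and $$E_\varepsilon(u)=\int_\Omega \frac\varepsilon2\|\nabla u\|^2+\frac{W(u)}\varepsilon\,dx .$$ Then the first convex-concave splitting step (with homogeneous Neumann boundary conditions), i.e. the minimization problem $$u_1\in\operatorname*{argmin}_{u\in H^1(\Omega)}\ \frac1{2\tau}\|u-u_0\|_{L^2(\Omega)}^2+\int_\Omega\frac\varepsilon2\|\nabla u\|^2+\frac{u^2+W_{conc}'(u_0)\,u}{\varepsilon}\,dx ,$$ has a solution $u_1$, which is unique up to equality almost everywhere in $\Omega$, and $$E_\varepsilon(u_1)\le\left(\sqrt2+\frac\varepsilon\tau\right)\mathrm{Per}(V).$$ In particular, if $\tau\ge\varepsilon$, then $E_\varepsilon(u_1)\le(\sqrt2+1)\,\mathrm{Per}(V)$.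 Here $\mathrm{Per}(V)=\sup\{\int_V\operatorname{div}\varphi\,dx:\varphi\in C_c^1(\mathbb R^d;\mathbb R^d),\ \|\varphi\|\le1\}$ is the perimeter of $V$. -/

import Mathlib

open MeasureTheory Set
open scoped Topology ContDiff ENNReal

namespace SharpInterface

noncomputable section

/-- `g` is a weak gradient of `u` on the open set `Ω`: both are locally integrable on `Ω`, and
`∫_Ω u ∇ψ = - ∫_Ω ψ g` for every smooth `ψ` with compact support in `Ω`. -/
def HasWeakGradient {d : ℕ} (Ω : Set (EuclideanSpace ℝ (Fin d)))
    (u : EuclideanSpace ℝ (Fin d) → ℝ)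
    (g : EuclideanSpace ℝ (Fin d) → EuclideanSpace ℝ (Fin d)) : Prop :=
  LocallyIntegrableOn u Ω ∧ LocallyIntegrableOn g Ω ∧
    ∀ ψ : EuclideanSpace ℝ (Fin d) → ℝ,
      ContDiff ℝ ∞ ψ → HasCompactSupport ψ → tsupport ψ ⊆ Ω →
        ∫ x in Ω, u x • gradient ψ x = - ∫ x in Ω, ψ x • g x

open Classical in
/-- The weak gradient of `u` on `Ω`. It is unique up to a null set where it exists; the value is
`0` if there is none. -/
def weakGradient {d : ℕ} (Ω : Set (EuclideanSpace ℝ (Fin d)))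
    (u : EuclideanSpace ℝ (Fin d) → ℝ) :
    EuclideanSpace ℝ (Fin d) → EuclideanSpace ℝ (Fin d) :=
  if h : ∃ g, HasWeakGradient Ω u g then h.choose else 0

/-- Membership in the Sobolev space `H¹(Ω)`. -/
def MemH1 {d : ℕ} (Ω : Set (EuclideanSpace ℝ (Fin d)))
    (u : EuclideanSpace ℝ (Fin d) → ℝ) : Prop :=
  MemLp u 2 (volume.restrict Ω) ∧
    ∃ g, HasWeakGradient Ω u g ∧ MemLp g 2 (volume.restrict Ω)

/-- The divergence of a vector field on `ℝᵈ`. -/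
def divergence {d : ℕ} (φ : EuclideanSpace ℝ (Fin d) → EuclideanSpace ℝ (Fin d))
    (x : EuclideanSpace ℝ (Fin d)) : ℝ :=
  ∑ i : Fin d, fderiv ℝ φ x (EuclideanSpace.single i 1) i

/-- The (De Giorgi) perimeter of a set `V ⊆ ℝᵈ`: the supremum of `∫_V div φ` over all compactly
supported `C¹` vector fields `φ` with `‖φ‖ ≤ 1` everywhere. -/
def perimeter {d : ℕ} (V : Set (EuclideanSpace ℝ (Fin d))) : ℝ≥0∞ :=
  ⨆ (φ : EuclideanSpace ℝ (Fin d) → EuclideanSpace ℝ (Fin d)) (_ : ContDiff ℝ 1 φ)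
    (_ : HasCompactSupport φ) (_ : ∀ x, ‖φ x‖ ≤ 1),
    ENNReal.ofReal (∫ x in V, divergence φ x)

/-- The open set `V` has a `C²` boundary: near each of its boundary points, `V` is the sublevel
set `{f < 0}` of a `C²` function `f` with nonvanishing derivative at that point. -/
def HasC2Boundary {d : ℕ} (V : Set (EuclideanSpace ℝ (Fin d))) : Prop :=
  ∀ x ∈ frontier V, ∃ (U : Set (EuclideanSpace ℝ (Fin d)))
    (f : EuclideanSpace ℝ (Fin d) → ℝ),
    IsOpen U ∧ x ∈ U ∧ ContDiffOn ℝ 2 f U ∧ f x = 0 ∧ fderiv ℝ f x ≠ 0 ∧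
      V ∩ U = {y ∈ U | f y < 0}

/-- The sharp interface function `χ_V - χ_{Vᶜ}`. -/
def sharpInterface {d : ℕ} (V : Set (EuclideanSpace ℝ (Fin d)))
    (x : EuclideanSpace ℝ (Fin d)) : ℝ :=
  V.indicator 1 x - Vᶜ.indicator 1 x

/-- The Modica-Mortola energy `E_ε(u) = ∫_Ω ε/2 ‖∇u‖² + W(u)/ε`, in `[0,∞]`
(for a nonnegative potential `W`). -/
def energy {d : ℕ} (Ω : Set (EuclideanSpace ℝ (Fin d))) (W : ℝ → ℝ) (ε : ℝ)
    (u : EuclideanSpace ℝ (Fin d) → ℝ) : ℝ≥0∞ :=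
  ∫⁻ x in Ω, ENNReal.ofReal (ε / 2 * ‖weakGradient Ω u x‖ ^ 2 + W (u x) / ε)

/-- The objective of one convex-concave splitting step of size `τ` from `u₀`, for the potential
`u² + Wconc(u)`, where the concave part is linearised at `u₀`. -/
def stepFunctional {d : ℕ} (Ω : Set (EuclideanSpace ℝ (Fin d))) (Wconc : ℝ → ℝ) (ε τ : ℝ)
    (u₀ u : EuclideanSpace ℝ (Fin d) → ℝ) : ℝ :=
  1 / (2 * τ) * (∫ x in Ω, (u x - u₀ x) ^ 2)
    + ∫ x in Ω, (ε / 2 * ‖weakGradient Ω u x‖ ^ 2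
        + (u x ^ 2 + deriv Wconc (u₀ x) * u x) / ε)

/-- `u₁` is a result of the convex-concave splitting step: a minimizer over `H¹(Ω)` of the step
functional (natural, i.e. homogeneous Neumann, boundary conditions). -/
def IsSplittingStep {d : ℕ} (Ω : Set (EuclideanSpace ℝ (Fin d))) (Wconc : ℝ → ℝ) (ε τ : ℝ)
    (u₀ u₁ : EuclideanSpace ℝ (Fin d) → ℝ) : Prop :=
  MemH1 Ω u₁ ∧ ∀ u, MemH1 Ω u →
    stepFunctional Ω Wconc ε τ u₀ u₁ ≤ stepFunctional Ω Wconc ε τ u₀ u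

end

end SharpInterface

/-!
Since `W ≥ 0` vanishes at `±1`, concavity gives `W t ≤ (t - s) ^ 2` and `deriv Wconc s = -2 * s`
for `s = ±1`. Completing the square, the splitting step minimizes
`∫ (1 / (2τ) + 1 / ε) (u - u₀) ^ 2 + ε / 2 ‖∇u‖ ^ 2` up to a constant: the minimizer is the
orthogonal projection of `(u₀, 0)` onto the graph of the weak gradient in a weighted `L²` space, and
the minimal value bounds its energy.

The minimal value is estimated with the competitor `2v - 1`, where `v - k⁻² Δv = f`, the function
`f` is a mollification of the indicator of `V`, and `k ^ 2` is the ratio of the two weights.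
Testing the equation gives `∫ k² (v - f) ^ 2 + ‖∇v‖ ^ 2 = - ∫ f Δv ≤ sup ‖∇v‖ · Per(V)`, and
comparing `v` with its reflections through an exponential barrier yields `‖∇v‖ ≤ k / 2`.
-/

namespace SharpInterface

open scoped SchwartzMap Laplacian LineDeriv RealInnerProductSpace

section Potential

variable {W Wconc : ℝ → ℝ} {s : ℝ}

/- With `y = s - r (t - s)` the point `s` is the convex combination `(y + r t) / (1 + r)`, and
`Wconc` is at least `-y²` at `y`. -/
theorem potential_le_mul_sq (hW : ∀ s, W s = s ^ 2 + Wconc s)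
    (hconc : ConcaveOn ℝ univ Wconc) (hWnonneg : ∀ s, 0 ≤ W s) (hs : W s = 0) (t : ℝ) {r : ℝ}
    (hr : 0 < r) : W t ≤ (1 + r) * (t - s) ^ 2 := by
  set y := s - r * (t - s) with hy
  have hcomb : (1 / (1 + r)) • y + (r / (1 + r)) • t = s := by
    rw [hy, smul_eq_mul, smul_eq_mul]
    field_simp
    ring
  have hchord : (Wconc y + r * Wconc t) / (1 + r) ≤ Wconc s :=
    calc (Wconc y + r * Wconc t) / (1 + r)
        = (1 / (1 + r)) • Wconc y + (r / (1 + r)) • Wconc t := by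
          rw [smul_eq_mul, smul_eq_mul]
          field_simp
      _ ≤ Wconc ((1 / (1 + r)) • y + (r / (1 + r)) • t) :=
          hconc.2 (mem_univ y) (mem_univ t) (by positivity) (by positivity) (by field_simp)
      _ = Wconc s := by rw [hcomb]
  rw [div_le_iff₀ (by positivity)] at hchord
  have hWs := hW s
  have hWy := (hWnonneg y).trans_eq (hW y)
  refine le_of_mul_le_mul_left ?_ hr
  rw [hW t]
  nlinarith

theorem potential_le_sq (hW : ∀ s, W s = s ^ 2 + Wconc s)
    (hconc : ConcaveOn ℝ univ Wconc) (hWnonneg : ∀ s, 0 ≤ W s) (hs : W s = 0) (t : ℝ) :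
    W t ≤ (t - s) ^ 2 := by
  have hlim : Filter.Tendsto (fun r : ℝ ↦ (1 + r) * (t - s) ^ 2) (𝓝[>] 0) (𝓝 ((t - s) ^ 2)) := by
    refine tendsto_nhdsWithin_of_tendsto_nhds (Continuous.tendsto' (by fun_prop) _ _ ?_)
    ring
  exact ge_of_tendsto hlim (eventually_mem_nhdsWithin.mono fun r hr ↦
    potential_le_mul_sq hW hconc hWnonneg hs t hr)

theorem hasDerivAt_of_potential (hW : ∀ s, W s = s ^ 2 + Wconc s)
    (hconc : ConcaveOn ℝ univ Wconc) (hWnonneg : ∀ s, 0 ≤ W s) (hs : W s = 0) :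
    HasDerivAt Wconc (-2 * s) s := by
  have hbound : W =O[𝓝 s] fun t ↦ ‖t - s‖ ^ 2 := Asymptotics.isBigO_of_le _ fun t ↦ by
    simpa [abs_of_nonneg (hWnonneg t)] using potential_le_sq hW hconc hWnonneg hs t
  have hderiv : HasDerivAt W 0 s := by simpa using (hbound.hasFDerivAt one_lt_two).hasDerivAt
  have := hderiv.sub (hasDerivAt_pow 2 s)
  refine (this.congr_of_eventuallyEq (.of_forall fun t ↦ ?_)).congr_deriv ?_
  · simp [hW t]
  · simp

end Potential

section Resolvent

variable {E F : Type*} [NormedAddCommGroup E] [InnerProductSpace ℝ E]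

/-- The Fourier symbol of the resolvent `(1 - k⁻² Δ)⁻¹`. The factor `2π` comes from the
normalization `e^{-2πi⟪x, ξ⟫}` of the Fourier transform. -/
noncomputable def resolventSymbol (k : ℝ) (ξ : E) : ℝ :=
  (1 + ‖(2 * Real.pi / k) • ξ‖ ^ 2)⁻¹

theorem hasTemperateGrowth_resolventSymbol (k : ℝ) :
    (resolventSymbol k : E → ℝ).HasTemperateGrowth := by
  have h := (Function.hasTemperateGrowth_one_add_norm_sq_rpow E (-1)).comp
    ((2 * Real.pi / k) • ContinuousLinearMap.id ℝ E).hasTemperateGrowth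
  simp only [Real.rpow_neg_one] at h
  exact h

theorem norm_sq_mul_resolventSymbol {k : ℝ} (hk : k ≠ 0) :
    (fun ξ : E ↦ ‖ξ‖ ^ 2) * resolventSymbol k
      = (k ^ 2 / (2 * Real.pi) ^ 2) • ((fun _ ↦ 1) - resolventSymbol k) := by
  ext ξ
  have : (k ^ 2 + (2 * Real.pi) ^ 2 * ‖ξ‖ ^ 2) ≠ 0 := by positivity
  simp only [resolventSymbol, Pi.mul_apply, Pi.smul_apply, Pi.sub_apply, smul_eq_mul, norm_smul,
    mul_pow, div_pow, Real.norm_eq_abs, sq_abs]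
  field_simp
  ring

variable [FiniteDimensional ℝ E]

theorem laplacian_postcompCLM {F G : Type*} [NormedAddCommGroup F] [NormedSpace ℝ F]
    [NormedAddCommGroup G] [NormedSpace ℝ G] (L : F →L[ℝ] G) (f : 𝓢(E, F)) :
    Δ (f.postcompCLM L) = (Δ f).postcompCLM L := by
  ext x
  rw [SchwartzMap.laplacian_apply, SchwartzMap.postcompCLM_apply, SchwartzMap.laplacian_apply]
  exact ((f.smooth 2).contDiffAt).laplacian_CLM_comp_left (l := L)

variable [MeasurableSpace E] [BorelSpace E] [NormedAddCommGroup F] [NormedSpace ℂ F]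

theorem fourierMultiplierCLM_sub_apply {g₁ g₂ : E → ℝ} (hg₁ : g₁.HasTemperateGrowth)
    (hg₂ : g₂.HasTemperateGrowth) (f : 𝓢(E, F)) :
    SchwartzMap.fourierMultiplierCLM F (g₁ - g₂) f
      = SchwartzMap.fourierMultiplierCLM F g₁ f - SchwartzMap.fourierMultiplierCLM F g₂ f := by
  rw [SchwartzMap.fourierMultiplierCLM_apply, SchwartzMap.smulLeftCLM_sub hg₁ hg₂]
  simp [SchwartzMap.fourierMultiplierCLM_apply, sub_eq_add_neg, FourierTransform.fourierInv_add,
    FourierTransform.fourierInv_neg]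

variable [CompleteSpace F]

theorem laplacian_fourierMultiplierCLM_resolventSymbol {k : ℝ} (hk : k ≠ 0) (f : 𝓢(E, F)) :
    Δ (SchwartzMap.fourierMultiplierCLM F (resolventSymbol k : E → ℝ) f)
      = k ^ 2 • (SchwartzMap.fourierMultiplierCLM F (resolventSymbol k : E → ℝ) f - f) := by
  have hm : (resolventSymbol k : E → ℝ).HasTemperateGrowth := hasTemperateGrowth_resolventSymbol k
  have hone : (fun _ : E ↦ (1 : ℝ)).HasTemperateGrowth := by fun_prop
  have hsq : (fun ξ : E ↦ ‖ξ‖ ^ 2).HasTemperateGrowth := by fun_prop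
  set v := SchwartzMap.fourierMultiplierCLM F (resolventSymbol k : E → ℝ) f with hv
  have hmul : SchwartzMap.fourierMultiplierCLM F (fun ξ : E ↦ ‖ξ‖ ^ 2) v
      = (k ^ 2 / (2 * Real.pi) ^ 2) • (f - v) := by
    rw [hv, SchwartzMap.fourierMultiplierCLM_fourierMultiplierCLM_apply hsq hm,
      norm_sq_mul_resolventSymbol hk, SchwartzMap.fourierMultiplierCLM_smul (hone.sub hm),
      _root_.smul_apply, fourierMultiplierCLM_sub_apply hone hm,
      SchwartzMap.fourierMultiplierCLM_const, one_smul, ContinuousLinearMap.id_apply]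
  rw [SchwartzMap.laplacian_eq_fourierMultiplierCLM]
  change -(2 * Real.pi) ^ 2 • SchwartzMap.fourierMultiplierCLM F (fun ξ : E ↦ ‖ξ‖ ^ 2) v = _
  rw [hmul, smul_smul, neg_mul, mul_div_cancel₀ _ (by positivity), neg_smul, ← smul_neg, neg_sub]

theorem exists_laplacian_eq_sq_mul_sub {k : ℝ} (hk : k ≠ 0) (f : 𝓢(E, ℝ)) :
    ∃ v : 𝓢(E, ℝ), ∀ x, Δ v x = k ^ 2 * (v x - f x) := by
  let v : 𝓢(E, ℂ) := SchwartzMap.fourierMultiplierCLM ℂ (resolventSymbol k : E → ℝ)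
    (f.postcompCLM Complex.ofRealCLM)
  refine ⟨v.postcompCLM Complex.reCLM, fun x ↦ ?_⟩
  rw [laplacian_postcompCLM, laplacian_fourierMultiplierCLM_resolventSymbol hk]
  simp [v]

end Resolvent

section MaximumPrinciple

theorem deriv_deriv_nonpos_of_isLocalMax {h : ℝ → ℝ} {t : ℝ} (hmax : IsLocalMax h t)
    (hc : ContinuousAt h t) : deriv (deriv h) t ≤ 0 := by
  by_contra! hpos
  have hmin := isLocalMin_of_deriv_deriv_pos hpos hmax.deriv_eq_zero hc
  have hconst : h =ᶠ[𝓝 t] fun _ ↦ h t := by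
    filter_upwards [hmax, hmin] with s h1 h2 using le_antisymm h1 h2
  rw [hconst.deriv.deriv_eq] at hpos
  simp at hpos

theorem hasDerivAt_le_of_forall_gt {g h : ℝ → ℝ} {g' h' a : ℝ} (hg : HasDerivAt g g' a)
    (hh : HasDerivAt h h' a) (ha : g a = h a) (hle : ∀ t > a, g t ≤ h t) : g' ≤ h' := by
  have hslope {p : ℝ → ℝ} {p' : ℝ} (hp : HasDerivAt p p' a) :
      Filter.Tendsto (slope p a) (𝓝[>] a) (𝓝 p') :=
    (hasDerivAt_iff_tendsto_slope.1 hp).mono_left (nhdsWithin_mono a fun _ ht ↦ ne_of_gt ht)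
  refine le_of_tendsto_of_tendsto (hslope hg) (hslope hh) ?_
  filter_upwards [self_mem_nhdsWithin] with t ht
  rw [slope_def_field, slope_def_field, ha]
  have : 0 < t - a := sub_pos.2 ht
  gcongr
  exact hle t ht

section Line

variable {E F : Type*} [NormedAddCommGroup E] [NormedSpace ℝ E] [NormedAddCommGroup F]
  [NormedSpace ℝ F]

theorem hasDerivAt_comp_add_smul {g : E → F} {y b : E} {t : ℝ}
    (hg : DifferentiableAt ℝ g (y + t • b)) :
    HasDerivAt (fun t : ℝ ↦ g (y + t • b)) (fderiv ℝ g (y + t • b) b) t := by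
  have hline : HasDerivAt (fun t : ℝ ↦ y + t • b) b t := by
    simpa using ((hasDerivAt_id t).smul_const b).const_add y
  exact hg.hasFDerivAt.comp_hasDerivAt t hline

theorem iteratedFDeriv_two_apply_self {p : E → F} (hp : ContDiff ℝ 2 p) (y b : E) :
    iteratedFDeriv ℝ 2 p y ![b, b] = deriv (deriv fun t : ℝ ↦ p (y + t • b)) 0 := by
  have hfirst : (deriv fun t : ℝ ↦ p (y + t • b)) = fun t ↦ fderiv ℝ p (y + t • b) b := by
    ext t
    exact (hasDerivAt_comp_add_smul (hp.differentiable two_ne_zero _)).deriv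
  have hdiff : Differentiable ℝ (fderiv ℝ p) :=
    (hp.fderiv_right (m := 1) (by norm_num)).differentiable one_ne_zero
  have hsecond := ((ContinuousLinearMap.apply ℝ F b).hasFDerivAt.comp_hasDerivAt 0
    (hasDerivAt_comp_add_smul (y := y) (b := b) (hdiff _))).deriv
  rw [hfirst, iteratedFDeriv_two_apply]
  refine Eq.trans ?_ hsecond.symm
  simp

end Line

variable {E : Type*} [NormedAddCommGroup E] [InnerProductSpace ℝ E] [FiniteDimensional ℝ E]

theorem laplacian_nonpos_of_isLocalMax {p : E → ℝ} (hp : ContDiff ℝ 2 p) {y : E}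
    (hmax : IsLocalMax p y) : Δ p y ≤ 0 := by
  rw [InnerProductSpace.laplacian_eq_iteratedFDeriv_orthonormalBasis p (stdOrthonormalBasis ℝ E)]
  refine Finset.sum_nonpos fun i _ ↦ ?_
  rw [iteratedFDeriv_two_apply_self hp]
  have hline : Continuous fun t : ℝ ↦ y + t • stdOrthonormalBasis ℝ E i := by fun_prop
  refine deriv_deriv_nonpos_of_isLocalMax ?_ (hp.continuous.comp hline).continuousAt
  have hlim := hline.tendsto 0
  rw [zero_smul, add_zero] at hlim
  simpa [IsLocalMax, IsMaxFilter] using hlim.eventually hmax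

theorem le_of_laplacian_pos {m : E → ℝ} (hm : ContDiff ℝ 2 m) {C : Set E} (hC : IsClosed C) {M : ℝ}
    (hfrontier : ∀ z ∈ frontier C, m z ≤ M)
    (hinfty : ∀ M' > M, ∀ᶠ z in Filter.cocompact E ⊓ Filter.principal C, m z ≤ M')
    (hpos : ∀ z ∈ interior C, M < m z → 0 < Δ m z) {y : E} (hy : y ∈ C) : m y ≤ M := by
  by_contra! hgt
  obtain ⟨z, hzC, hzmax⟩ := hm.continuous.continuousOn.exists_isMaxOn' hC hy (hinfty (m y) hgt)
  have hzgt : M < m z := hgt.trans_le (hzmax hy)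
  have hzint : z ∈ interior C := by
    by_contra hz
    exact hzgt.not_ge (hfrontier z ⟨subset_closure hzC, hz⟩)
  have hloc : IsLocalMax m z := hzmax.isLocalMax (mem_interior_iff_mem_nhds.1 hzint)
  exact (laplacian_nonpos_of_isLocalMax hm hloc).not_gt (hpos z hzint hzgt)

end MaximumPrinciple

section GradientBound

variable {E : Type*} [NormedAddCommGroup E] [InnerProductSpace ℝ E]

theorem contDiff_exp_inner (k : ℝ) (e : E) {n : ℕ∞ω} :
    ContDiff ℝ n fun z : E ↦ Real.exp (-k * ⟪e, z⟫) :=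
  (contDiff_const.mul (contDiff_const.inner ℝ contDiff_id)).exp

variable [FiniteDimensional ℝ E]

theorem laplacian_comp_add_linearIsometryEquiv {F : Type*} [NormedAddCommGroup F]
    [NormedSpace ℝ F] {p : E → F} (hp : ContDiff ℝ 2 p) (R : E ≃ₗᵢ[ℝ] E) (x y : E) :
    Δ (fun z ↦ p (x + R z)) y = Δ p (x + R y) := by
  rw [InnerProductSpace.laplacian_eq_iteratedFDeriv_orthonormalBasis _ (stdOrthonormalBasis ℝ E),
    InnerProductSpace.laplacian_eq_iteratedFDeriv_orthonormalBasis p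
      ((stdOrthonormalBasis ℝ E).map R)]
  refine Finset.sum_congr rfl fun i _ ↦ ?_
  have hcomp := (R.toContinuousLinearEquiv : E →L[ℝ] E).iteratedFDeriv_comp_right
    (f := fun z ↦ p (x + z)) (hp.comp (contDiff_const.add contDiff_id)) y (i := 2) le_rfl
  change iteratedFDeriv ℝ 2 ((fun z ↦ p (x + z)) ∘ (R.toContinuousLinearEquiv : E →L[ℝ] E)) y _ = _
  rw [hcomp, iteratedFDeriv_comp_add_left]
  simp only [ContinuousMultilinearMap.compContinuousLinearMap_apply, OrthonormalBasis.map_apply]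
  congr 1
  ext j
  fin_cases j <;> rfl

theorem laplacian_exp_inner (k : ℝ) (e y : E) :
    Δ (fun z : E ↦ Real.exp (-k * ⟪e, z⟫)) y = (k * ‖e‖) ^ 2 * Real.exp (-k * ⟪e, y⟫) := by
  have hline (b : E) : deriv (deriv fun t : ℝ ↦ Real.exp (-k * ⟪e, y + t • b⟫)) 0
      = k ^ 2 * Real.exp (-k * ⟪e, y⟫) * ⟪e, b⟫ ^ 2 := by
    have hinner (t : ℝ) : HasDerivAt (fun t : ℝ ↦ -k * ⟪e, y + t • b⟫) (-k * ⟪e, b⟫) t := by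
      simp only [inner_add_right, inner_smul_right]
      simpa using (((hasDerivAt_id t).mul_const ⟪e, b⟫).const_add ⟪e, y⟫).const_mul (-k)
    have hfirst : (deriv fun t : ℝ ↦ Real.exp (-k * ⟪e, y + t • b⟫))
        = fun t ↦ Real.exp (-k * ⟪e, y + t • b⟫) * (-k * ⟪e, b⟫) := by
      ext t
      exact (hinner t).exp.deriv
    rw [hfirst, ((hinner 0).exp.mul_const _).deriv, zero_smul, add_zero]
    ring
  rw [InnerProductSpace.laplacian_eq_iteratedFDeriv_orthonormalBasis _ (stdOrthonormalBasis ℝ E)]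
  simp_rw [iteratedFDeriv_two_apply_self (contDiff_exp_inner k e), hline]
  rw [← Finset.mul_sum, (stdOrthonormalBasis ℝ E).sum_sq_inner_left]
  ring

variable {k c : ℝ} {f v : E → ℝ}

/- The barrier `c (1 - exp (-k ⟪e, y⟫))` solves the equation with right-hand side `c` and vanishes
on the boundary of the half-space. -/
theorem le_mul_one_sub_exp_of_laplacian_eq (hk : 0 < k) (hv2 : ContDiff ℝ 2 v)
    (hv0 : Filter.Tendsto v (Filter.cocompact E) (𝓝 0))
    (hv : ∀ x, Δ v x = k ^ 2 * (v x - f x)) (hc : 0 ≤ c) (hf : ∀ x, f x ≤ c)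
    {e : E} (he : ‖e‖ = 1) (hzero : ∀ z, ⟪e, z⟫ = 0 → v z = 0) {y : E} (hy : 0 ≤ ⟪e, y⟫) :
    v y ≤ c * (1 - Real.exp (-k * ⟪e, y⟫)) := by
  let b (z : E) : ℝ := Real.exp (-k * ⟪e, z⟫)
  have hb2 : ContDiff ℝ 2 b := contDiff_exp_inner k e
  have hcb2 : ContDiff ℝ 2 (c • b) := hb2.const_smul c
  have hlap (z : E) : Δ (v + c • b) z = k ^ 2 * ((v + c • b) z - f z) := by
    rw [hv2.contDiffAt.laplacian_add hcb2.contDiffAt,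
      InnerProductSpace.laplacian_smul _ hb2.contDiffAt, laplacian_exp_inner, hv, he]
    simp only [b, Pi.add_apply, Pi.smul_apply, smul_eq_mul]
    ring
  have hle : (v + c • b) y ≤ c := by
    refine le_of_laplacian_pos (m := v + c • b) (hv2.add hcb2) (C := {z : E | 0 ≤ ⟪e, z⟫})
      (isClosed_le continuous_const (by fun_prop)) (fun z hz ↦ ?_) (fun M' hM' ↦ ?_)
      (fun z _ hz ↦ ?_) hy
    · have hinner : 0 = ⟪e, z⟫ := frontier_le_subset_eq continuous_const (by fun_prop) hz
      simp [b, hzero z hinner.symm, ← hinner]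
    · rw [Filter.eventually_inf_principal]
      filter_upwards [hv0.eventually (gt_mem_nhds (sub_pos.2 hM'))] with z hz hz0
      have hb1 : b z ≤ 1 := by
        rw [Real.exp_le_one_iff, neg_mul, neg_nonpos]
        exact mul_nonneg hk.le hz0
      have hcb : c * b z ≤ c := mul_le_of_le_one_right hc hb1
      rw [Pi.add_apply, Pi.smul_apply, smul_eq_mul]
      linarith
    · rw [hlap]
      exact mul_pos (by positivity) (by linarith [hf z])
  simp only [b, Pi.add_apply, Pi.smul_apply, smul_eq_mul] at hle
  linarith

theorem sub_reflection_le_of_laplacian_eq (hk : 0 < k) (hv2 : ContDiff ℝ 2 v)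
    (hv0 : Filter.Tendsto v (Filter.cocompact E) (𝓝 0))
    (hv : ∀ x, Δ v x = k ^ 2 * (v x - f x)) (hf : ∀ x y, f x - f y ≤ c)
    {e : E} (he : ‖e‖ = 1) (x : E) {y : E} (hy : 0 ≤ ⟪e, y⟫) :
    v (x + y) - v (x + (ℝ ∙ e)ᗮ.reflection y) ≤ c * (1 - Real.exp (-k * ⟪e, y⟫)) := by
  set R := (ℝ ∙ e)ᗮ.reflection
  let w (S : E ≃ₗᵢ[ℝ] E) (z : E) : ℝ := v (x + S z)
  have hw2 (S : E ≃ₗᵢ[ℝ] E) : ContDiff ℝ 2 (w S) :=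
    hv2.comp (contDiff_const.add S.toContinuousLinearEquiv.contDiff)
  have hw0 (S : E ≃ₗᵢ[ℝ] E) : Filter.Tendsto (w S) (Filter.cocompact E) (𝓝 0) :=
    hv0.comp ((Homeomorph.addLeft x).isClosedEmbedding.tendsto_cocompact.comp
      S.toHomeomorph.isClosedEmbedding.tendsto_cocompact)
  refine le_mul_one_sub_exp_of_laplacian_eq (v := w (.refl ℝ E) - w R)
    (f := fun z ↦ f (x + z) - f (x + R z)) hk ((hw2 _).sub (hw2 _)) ?_ (fun z ↦ ?_)
    (by simpa using hf 0 0) (fun z ↦ hf _ _) he (fun z hz ↦ ?_) hy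
  · exact sub_zero (0 : ℝ) ▸ (hw0 (.refl ℝ E)).sub (hw0 R)
  · rw [ContDiffAt.laplacian_sub (hw2 _).contDiffAt (hw2 _).contDiffAt,
      laplacian_comp_add_linearIsometryEquiv hv2, laplacian_comp_add_linearIsometryEquiv hv2,
      hv, hv]
    simp only [w, Pi.sub_apply, LinearIsometryEquiv.coe_refl, id_eq]
    ring
  · have hRz : R z = z := Submodule.reflection_mem_subspace_eq_self
      (Submodule.mem_orthogonal_singleton_iff_inner_right.2 hz)
    simp [w, hRz]

theorem fderiv_apply_le_of_laplacian_eq (hk : 0 < k) (hv2 : ContDiff ℝ 2 v)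
    (hv0 : Filter.Tendsto v (Filter.cocompact E) (𝓝 0))
    (hv : ∀ x, Δ v x = k ^ 2 * (v x - f x)) (hf : ∀ x y, f x - f y ≤ c)
    {e : E} (he : ‖e‖ = 1) (x : E) : fderiv ℝ v x e ≤ k * c / 2 := by
  have hle (t : ℝ) (ht : 0 < t) :
      v (x + t • e) - v (x + t • -e) ≤ c * (1 - Real.exp (-k * t)) := by
    have hinner : ⟪e, t • e⟫ = t := by simp [inner_smul_right, he]
    have h := sub_reflection_le_of_laplacian_eq hk hv2 hv0 hv hf he x (y := t • e)
      (by rw [hinner]; exact ht.le)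
    rwa [hinner, map_smul, Submodule.reflection_orthogonalComplement_singleton_eq_neg] at h
  have hline (b : E) : HasDerivAt (fun t : ℝ ↦ v (x + t • b)) (fderiv ℝ v x b) 0 := by
    simpa using hasDerivAt_comp_add_smul (t := 0) (hv2.differentiable two_ne_zero (x + (0 : ℝ) • b))
  have hbarrier : HasDerivAt (fun t : ℝ ↦ c * (1 - Real.exp (-k * t))) (c * k) 0 := by
    simpa using (((hasDerivAt_id (0 : ℝ)).const_mul (-k)).exp.const_sub 1).const_mul c
  have h := hasDerivAt_le_of_forall_gt ((hline e).sub (hline (-e))) hbarrier (by simp) hle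
  rw [map_neg] at h
  linarith

theorem norm_gradient_le_of_laplacian_eq (hk : 0 < k) (hv2 : ContDiff ℝ 2 v)
    (hv0 : Filter.Tendsto v (Filter.cocompact E) (𝓝 0))
    (hv : ∀ x, Δ v x = k ^ 2 * (v x - f x)) (hf : ∀ x y, f x - f y ≤ c) (x : E) :
    ‖gradient v x‖ ≤ k * c / 2 := by
  rcases eq_or_ne (gradient v x) 0 with h0 | h0
  · have hc : 0 ≤ c := by simpa using hf 0 0
    rw [h0, norm_zero]
    positivity
  · have h := fderiv_apply_le_of_laplacian_eq hk hv2 hv0 hv hf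
      (norm_smul_inv_norm (𝕜 := ℝ) h0) x
    rw [map_smul, ← inner_gradient_left, real_inner_self_eq_norm_sq, smul_eq_mul, pow_two] at h
    simpa [norm_ne_zero_iff.2 h0] using h

end GradientBound

section EnergyIdentity

variable {E : Type*} [NormedAddCommGroup E] [InnerProductSpace ℝ E] [FiniteDimensional ℝ E]

theorem norm_gradient_sq_eq_sum_lineDeriv (v : 𝓢(E, ℝ)) (x : E) :
    ‖gradient v x‖ ^ 2 = ∑ i, (∂_{stdOrthonormalBasis ℝ E i} v) x
      * (∂_{stdOrthonormalBasis ℝ E i} v) x := by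
  rw [← (stdOrthonormalBasis ℝ E).sum_sq_inner_left]
  refine Finset.sum_congr rfl fun i _ ↦ ?_
  rw [SchwartzMap.lineDerivOp_apply_eq_fderiv, inner_gradient_left, pow_two]

variable [MeasurableSpace E] [BorelSpace E]

theorem integrable_mul_schwartzMap (f g : 𝓢(E, ℝ)) : Integrable fun x ↦ f x * g x :=
  (SchwartzMap.pairing (ContinuousLinearMap.mul ℝ ℝ) f g).integrable

theorem integrable_norm_gradient_sq (v : 𝓢(E, ℝ)) : Integrable fun x ↦ ‖gradient v x‖ ^ 2 := by
  simp_rw [norm_gradient_sq_eq_sum_lineDeriv]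
  exact integrable_finsetSum _ fun i _ ↦ integrable_mul_schwartzMap _ _

theorem integral_norm_gradient_sq (v : 𝓢(E, ℝ)) :
    ∫ x, ‖gradient v x‖ ^ 2 = - ∫ x, v x * Δ v x := by
  simp_rw [norm_gradient_sq_eq_sum_lineDeriv,
    SchwartzMap.laplacian_eq_sum (stdOrthonormalBasis ℝ E), sum_apply, Finset.mul_sum]
  rw [integral_finsetSum _ fun i _ ↦ integrable_mul_schwartzMap _ _,
    integral_finsetSum _ fun i _ ↦ integrable_mul_schwartzMap _ _, ← Finset.sum_neg_distrib]
  refine Finset.sum_congr rfl fun i _ ↦ ?_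
  rw [SchwartzMap.integral_mul_lineDerivOp_right_eq_neg_left]
  simp_rw [mul_comm]

theorem integral_sq_sub_add_norm_gradient_sq {k : ℝ} {f v : 𝓢(E, ℝ)}
    (hv : ∀ x, Δ v x = k ^ 2 * (v x - f x)) :
    ∫ x, (k ^ 2 * (v x - f x) ^ 2 + ‖gradient v x‖ ^ 2) = - ∫ x, f x * Δ v x := by
  have hsq (x : E) : k ^ 2 * (v x - f x) ^ 2 = v x * Δ v x - f x * Δ v x := by
    rw [hv]
    ring
  have hvΔ := integrable_mul_schwartzMap v (Δ v)
  have hfΔ := integrable_mul_schwartzMap f (Δ v)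
  have hsub : Integrable fun x ↦ v x * Δ v x - f x * Δ v x := hvΔ.sub hfΔ
  simp_rw [hsq]
  rw [integral_add hsub (integrable_norm_gradient_sq v), integral_sub hvΔ hfΔ,
    integral_norm_gradient_sq]
  ring

end EnergyIdentity

section Variation

variable {d : ℕ}

local notation "𝔼" => EuclideanSpace ℝ (Fin d)

theorem divergence_comp_add_right (φ : 𝔼 → 𝔼) (t x : 𝔼) :
    divergence (fun y ↦ φ (y + t)) x = divergence φ (x + t) := by
  simp only [divergence, fderiv_comp_add_right]

theorem divergence_const_smul (c : ℝ) (φ : 𝔼 → 𝔼) (x : 𝔼) :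
    divergence (c • φ) x = c * divergence φ x := by
  simp [divergence, fderiv_const_smul_field, Finset.mul_sum]

theorem divergence_congr_of_eventuallyEq {φ ψ : 𝔼 → 𝔼} {x : 𝔼} (h : φ =ᶠ[𝓝 x] ψ) :
    divergence φ x = divergence ψ x := by
  simp only [divergence, h.fderiv_eq]

theorem continuous_divergence {φ : 𝔼 → 𝔼} (hφ : ContDiff ℝ 1 φ) : Continuous (divergence φ) := by
  unfold divergence
  have := hφ.continuous_fderiv one_ne_zero
  fun_prop

theorem hasCompactSupport_divergence {φ : 𝔼 → 𝔼} (hφ : HasCompactSupport φ) :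
    HasCompactSupport (divergence φ) := by
  refine (hφ.fderiv (𝕜 := ℝ)).mono fun x hx ↦ ?_
  contrapose! hx
  simp [divergence, Function.notMem_support.1 hx]

theorem gradient_apply (v : 𝔼 → ℝ) (x : 𝔼) (i : Fin d) :
    gradient v x i = fderiv ℝ v x (EuclideanSpace.single i 1) := by
  rw [← inner_gradient_left, EuclideanSpace.inner_single_right]
  simp

theorem contDiff_gradient {v : 𝔼 → ℝ} {m n : ℕ∞ω} (hv : ContDiff ℝ n v) (hmn : m + 1 ≤ n) :
    ContDiff ℝ m (gradient v) := by
  rw [contDiff_euclidean]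
  intro i
  simp_rw [gradient_apply]
  exact (hv.fderiv_right hmn).clm_apply contDiff_const

theorem divergence_gradient {v : 𝔼 → ℝ} (hv : ContDiff ℝ 2 v) (x : 𝔼) :
    divergence (gradient v) x = Δ v x := by
  have hgrad : Differentiable ℝ (gradient v) :=
    (contDiff_gradient hv (m := 1) (by norm_num)).differentiable one_ne_zero
  have hfderiv : Differentiable ℝ (fderiv ℝ v) :=
    (hv.fderiv_right (m := 1) (by norm_num)).differentiable one_ne_zero
  rw [InnerProductSpace.laplacian_eq_iteratedFDeriv_orthonormalBasis v
    (EuclideanSpace.basisFun (Fin d) ℝ)]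
  refine Finset.sum_congr rfl fun i _ ↦ ?_
  have hcoord : (fun y ↦ gradient v y i) = fun y ↦ fderiv ℝ v y (EuclideanSpace.single i 1) :=
    funext fun y ↦ gradient_apply v y i
  have hproj := ((EuclideanSpace.proj i : 𝔼 →L[ℝ] ℝ).hasFDerivAt.comp x
    (hgrad x).hasFDerivAt).fderiv
  have happly := ((hfderiv x).hasFDerivAt.clm_apply
    (hasFDerivAt_const (EuclideanSpace.single i (1 : ℝ)) x)).fderiv
  have heq := hproj.symm.trans ((congrArg (fderiv ℝ · x) hcoord).trans happly)
  simpa [iteratedFDeriv_two_apply] using DFunLike.congr_fun heq (EuclideanSpace.single i 1)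

/-- The total variation of `f` on `ℝᵈ` is at most `P`: the defining integrals
`∫ f div φ` over compactly supported `C¹` fields with `‖φ‖ ≤ 1` are all bounded by `P`. -/
def VariationLE (f : 𝔼 → ℝ) (P : ℝ) : Prop :=
  ∀ φ : 𝔼 → 𝔼, ContDiff ℝ 1 φ → HasCompactSupport φ → (∀ x, ‖φ x‖ ≤ 1) →
    ∫ x, f x * divergence φ x ≤ P

theorem variationLE_indicator {V : Set 𝔼} (hV : MeasurableSet V) (hP : perimeter V ≠ ⊤) :
    VariationLE (V.indicator 1) (perimeter V).toReal := by
  intro φ hφ hφc hφ1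
  have hind : ∫ x, V.indicator 1 x * divergence φ x = ∫ x in V, divergence φ x := by
    rw [← integral_indicator hV]
    congr with x
    by_cases hx : x ∈ V <;> simp [hx]
  rw [hind]
  refine (ENNReal.ofReal_le_iff_le_toReal hP).1 ?_
  exact le_iSup_of_le φ (le_iSup_of_le hφ (le_iSup_of_le hφc (le_iSup_of_le hφ1 le_rfl)))

open scoped Convolution in
theorem integral_convolution_mul_eq {f η g : 𝔼 → ℝ} (hf : Integrable f) (hη : Integrable η)
    (hg : Continuous g) (hgc : HasCompactSupport g) :
    Integrable (fun t ↦ η t * ∫ x, f x * g (x + t)) ∧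
    ∫ x, (η ⋆[ContinuousLinearMap.lsmul ℝ ℝ] f) x * g x = ∫ t, η t * ∫ x, f x * g (x + t) := by
  obtain ⟨C, hC⟩ := hgc.exists_bound_of_continuous hg
  have hint : Integrable (fun p : 𝔼 × 𝔼 ↦ η p.2 * f (p.1 - p.2) * g p.1)
      (volume.prod volume) :=
    (hη.convolution_integrand (ContinuousLinearMap.lsmul ℝ ℝ) hf).mul_bdd
      (hg.comp continuous_fst).aestronglyMeasurable (.of_forall fun p ↦ hC p.1)
  have hinner (t : 𝔼) : ∫ x, η t * f (x - t) * g x = η t * ∫ x, f x * g (x + t) := by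
    simp_rw [mul_assoc]
    rw [integral_const_mul, ← integral_add_right_eq_self (fun x ↦ f (x - t) * g x) t]
    simp_rw [add_sub_cancel_right]
  refine ⟨by simpa only [hinner] using hint.integral_prod_right, ?_⟩
  simp_rw [convolution_lsmul, smul_eq_mul, ← integral_mul_const]
  rw [integral_integral_swap hint]
  simp_rw [hinner]

open scoped Convolution in
theorem VariationLE.convolution {f η : 𝔼 → ℝ} {P : ℝ} (hf : VariationLE f P)
    (hfi : Integrable f) (hηi : Integrable η) (hη0 : ∀ x, 0 ≤ η x) (hη1 : ∫ x, η x = 1) :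
    VariationLE (η ⋆[ContinuousLinearMap.lsmul ℝ ℝ] f) P := by
  intro φ hφ hφc hφ1
  obtain ⟨hint, heq⟩ := integral_convolution_mul_eq hfi hηi (continuous_divergence hφ)
    (hasCompactSupport_divergence hφc)
  have htranslate (t : 𝔼) : ∫ x, f x * divergence φ (x + t) ≤ P := by
    simp_rw [← divergence_comp_add_right φ t]
    exact hf _ (by fun_prop) (hφc.comp_homeomorph (Homeomorph.addRight t)) fun x ↦ hφ1 _
  calc ∫ x, (η ⋆[ContinuousLinearMap.lsmul ℝ ℝ] f) x * divergence φ x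
      = ∫ t, η t * ∫ x, f x * divergence φ (x + t) := heq
    _ ≤ ∫ t, η t * P :=
        integral_mono hint (hηi.mul_const P) fun t ↦
          mul_le_mul_of_nonneg_left (htranslate t) (hη0 t)
    _ = P := by rw [integral_mul_const, hη1, one_mul]

theorem VariationLE.integral_mul_divergence_le {f : 𝔼 → ℝ} {P : ℝ} (hf : VariationLE f P)
    (hfc : HasCompactSupport f) {φ : 𝔼 → 𝔼} (hφ : ContDiff ℝ 1 φ) (hφ1 : ∀ x, ‖φ x‖ ≤ 1) :
    ∫ x, f x * divergence φ x ≤ P := by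
  obtain ⟨R, hR0, hR⟩ := hfc.isCompact.isBounded.subset_ball_lt 0 0
  let ζ : ContDiffBump (0 : 𝔼) := ⟨R, R + 1, hR0, lt_add_one R⟩
  have hdiv (x : 𝔼) : f x * divergence φ x = f x * divergence (fun y ↦ ζ y • φ y) x := by
    by_cases hx : x ∈ tsupport f
    · congr 1
      refine divergence_congr_of_eventuallyEq ?_
      filter_upwards [ζ.eventuallyEq_one_of_mem_ball (hR hx)] with y hy
      simp [hy]
    · simp [image_eq_zero_of_notMem_tsupport hx]
  simp_rw [hdiv]
  refine hf _ (ζ.contDiff.smul hφ) ζ.hasCompactSupport.smul_right fun x ↦ ?_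
  rw [norm_smul, Real.norm_of_nonneg ζ.nonneg]
  exact mul_le_one₀ ζ.le_one (norm_nonneg _) (hφ1 x)

theorem VariationLE.neg_integral_mul_laplacian_le {f : 𝔼 → ℝ} {P : ℝ} (hf : VariationLE f P)
    (hfc : HasCompactSupport f) {v : 𝔼 → ℝ} (hv : ContDiff ℝ 2 v) {M : ℝ} (hM : 0 < M)
    (hvM : ∀ x, ‖gradient v x‖ ≤ M) : - ∫ x, f x * Δ v x ≤ M * P := by
  have hfield : ContDiff ℝ 1 (-M⁻¹ • gradient v) :=
    (contDiff_gradient hv (by norm_num)).const_smul (-M⁻¹)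
  have hbound (x : 𝔼) : ‖(-M⁻¹ • gradient v) x‖ ≤ 1 := by
    rw [Pi.smul_apply, norm_smul, norm_neg, norm_inv, Real.norm_of_nonneg hM.le,
      inv_mul_le_one₀ hM]
    exact hvM x
  have h := hf.integral_mul_divergence_le hfc hfield hbound
  simp_rw [divergence_const_smul, divergence_gradient hv, mul_left_comm (f _)] at h
  rwa [integral_const_mul, neg_mul, ← mul_neg, inv_mul_le_iff₀ hM] at h

end Variation

section Mollification

open Filter Function
open scoped Convolution

variable {G F : Type*} [NormedAddCommGroup G] [NormedSpace ℝ G] [FiniteDimensional ℝ G]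
  [MeasurableSpace G] [BorelSpace G] {μ : Measure G} [μ.IsAddHaarMeasure]
  [NormedAddCommGroup F] [NormedSpace ℝ F]

theorem support_normed_convolution_subset (φ : ContDiffBump (0 : G)) (g : G → F) :
    support (φ.normed μ ⋆[ContinuousLinearMap.lsmul ℝ ℝ, μ] g) ⊆
      Metric.thickening φ.rOut (support g) := by
  rw [← add_ball_zero, ← φ.support_normed_eq (μ := μ)]
  exact support_convolution_subset_swap _

theorem contDiff_normed_convolution (φ : ContDiffBump (0 : G)) {g : G → F}
    (hg : LocallyIntegrable g μ) :
    ContDiff ℝ ∞ (φ.normed μ ⋆[ContinuousLinearMap.lsmul ℝ ℝ, μ] g) :=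
  φ.hasCompactSupport_normed.contDiff_convolution_left _ φ.contDiff_normed hg

variable [CompleteSpace F]

theorem dist_normed_convolution_le_of_forall (φ : ContDiffBump (0 : G)) {g : G → F}
    (hg : AEStronglyMeasurable g μ) {z : F} {C : ℝ} (hC : ∀ x, dist (g x) z ≤ C) (x : G) :
    dist ((φ.normed μ ⋆[ContinuousLinearMap.lsmul ℝ ℝ, μ] g) x) z ≤ C :=
  dist_convolution_le (dist_nonneg.trans (hC x)) (φ.support_normed_eq (μ := μ)).subset
    φ.nonneg_normed φ.integral_normed hg fun y _ ↦ hC y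

theorem tendsto_integral_norm_normed_convolution_sub_sq {ι : Type*} {l : Filter ι}
    [l.IsCountablyGenerated] {φ : ι → ContDiffBump (0 : G)} {K : ℝ}
    (hφ : Tendsto (fun i ↦ (φ i).rOut) l (𝓝 0))
    (hφK : ∀ᶠ i in l, (φ i).rOut ≤ K * (φ i).rIn) {g : G → F} (hg : AEStronglyMeasurable g μ)
    {C : ℝ} (hgC : ∀ x, ‖g x‖ ≤ C) (hgs : Bornology.IsBounded (support g)) :
    Tendsto (fun i ↦ ∫ x, ‖((φ i).normed μ ⋆[ContinuousLinearMap.lsmul ℝ ℝ, μ] g) x - g x‖ ^ 2 ∂μ)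
      l (𝓝 0) := by
  have hgint : LocallyIntegrable g μ :=
    ((integrableOn_iff_integrable_of_support_subset subset_rfl).1
      (Measure.integrableOn_of_bounded hgs.measure_lt_top.ne hg
        (.of_forall hgC))).locallyIntegrable
  let S : Set G := Metric.thickening 1 (support g)
  have hSm : MeasurableSet S := Metric.isOpen_thickening.measurableSet
  rw [show (0 : ℝ) = ∫ _ : G, (0 : ℝ) ∂μ from (integral_zero _ _).symm]
  refine tendsto_integral_filter_of_dominated_convergence (S.indicator fun _ ↦ (C + C) ^ 2)
    (.of_forall fun i ↦ ?_) ?_ ?_ ?_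
  · exact ((contDiff_normed_convolution (φ i)
      hgint).continuous.aestronglyMeasurable.sub hg).norm.pow 2
  · filter_upwards [hφ.eventually_lt_const one_pos] with i hi
    refine .of_forall fun x ↦ ?_
    by_cases hx : x ∈ S
    · rw [indicator_of_mem hx, norm_pow, norm_norm]
      have hconv := dist_normed_convolution_le_of_forall (φ i) hg
        (z := 0) (by simpa using hgC) x
      rw [dist_zero_right] at hconv
      gcongr
      exact (norm_sub_le _ _).trans (add_le_add hconv (hgC x))
    · have hgx : g x = 0 := notMem_support.1 fun h ↦ hx (Metric.self_subset_thickening one_pos _ h)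
      have hconv := notMem_support.1 fun h ↦ hx
        (Metric.thickening_mono hi.le _ (support_normed_convolution_subset (μ := μ) (φ i) g h))
      simp [hgx, hconv, indicator_of_notMem hx]
  · exact (integrable_indicator_iff hSm).2 (integrableOn_const hgs.thickening.measure_lt_top.ne)
  · filter_upwards [ContDiffBump.ae_convolution_tendsto_right_of_locallyIntegrable hφ hφK hgint]
      with x hx
    simpa using (hx.sub_const (g x)).norm.pow 2

end Mollification

section MollifiedSet

open Filter Function
open scoped Convolution

variable {d : ℕ}

local notation "𝔼" => EuclideanSpace ℝ (Fin d)

theorem exists_contDiff_variationLE {V : Set 𝔼} (hV : MeasurableSet V)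
    (hVb : Bornology.IsBounded V) (hP : perimeter V ≠ ⊤) {δ : ℝ} (hδ : 0 < δ) :
    ∃ f : 𝔼 → ℝ, ContDiff ℝ ∞ f ∧ HasCompactSupport f ∧ (∀ x y, f x - f y ≤ 1) ∧
      ∫ x, (f x - V.indicator 1 x) ^ 2 < δ ∧ VariationLE f (perimeter V).toReal := by
  let φ (n : ℕ) : ContDiffBump (0 : 𝔼) :=
    ⟨1 / (n + 1), 2 * (1 / (n + 1)), Nat.one_div_pos_of_nat,
      lt_two_mul_self Nat.one_div_pos_of_nat⟩
  have hφ : Tendsto (fun n ↦ (φ n).rOut) atTop (𝓝 0) := by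
    simpa [φ] using tendsto_one_div_add_atTop_nhds_zero_nat.const_mul (2 : ℝ)
  have hmeas : AEStronglyMeasurable (V.indicator (1 : 𝔼 → ℝ)) :=
    (measurable_one.indicator hV).aestronglyMeasurable
  have hint : Integrable (V.indicator (1 : 𝔼 → ℝ)) :=
    (integrable_indicator_iff hV).2 (integrableOn_const hVb.measure_lt_top.ne)
  have hsupp : Bornology.IsBounded (support (V.indicator (1 : 𝔼 → ℝ))) :=
    hVb.subset support_indicator_subset
  have hlim := tendsto_integral_norm_normed_convolution_sub_sq (C := 1) hφ
    (.of_forall fun n ↦ le_rfl) hmeas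
    (fun x ↦ by by_cases hx : x ∈ V <;> simp [hx]) hsupp
  obtain ⟨n, hn⟩ := (hlim.eventually_lt_const hδ).exists
  have hdist := dist_normed_convolution_le_of_forall (μ := volume) (φ n) (z := 1 / 2) (C := 1 / 2)
    hmeas fun x ↦ by by_cases hx : x ∈ V <;> norm_num [hx, Real.dist_eq, abs_of_pos]
  refine ⟨_, contDiff_normed_convolution (φ n) hint.locallyIntegrable, ?_, fun x y ↦ ?_,
    by simpa only [Real.norm_eq_abs, sq_abs] using hn,
    (variationLE_indicator hV hP).convolution hint (φ n).integrable_normed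
      (φ n).nonneg_normed (φ n).integral_normed⟩
  · exact (φ n).hasCompactSupport_normed.convolution _ hsupp.isCompact_closure
  · linarith [(abs_le.1 (hdist x)).2, (abs_le.1 (hdist y)).1]

end MollifiedSet

section WeightedProjection

theorem existsUnique_isMinOn_norm_sub {H : Type*} [NormedAddCommGroup H] [InnerProductSpace ℝ H]
    (K : Submodule ℝ H) [K.HasOrthogonalProjection] (z : H) :
    ∃! p, p ∈ K ∧ IsMinOn (fun q ↦ ‖z - q‖) K p := by
  refine ⟨K.starProjection z, ⟨Submodule.coe_mem _, fun q hq ↦ ?_⟩, fun p ⟨hpK, hp⟩ ↦ ?_⟩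
  · exact (Submodule.starProjection_minimal z).trans_le <|
      ciInf_le ⟨0, forall_mem_range.2 fun _ ↦ norm_nonneg _⟩ (⟨q, hq⟩ : K)
  · have hinf : ‖z - p‖ = ⨅ q : K, ‖z - q‖ :=
      le_antisymm (le_ciInf fun q ↦ hp q.2)
        (ciInf_le ⟨0, forall_mem_range.2 fun _ ↦ norm_nonneg _⟩ (⟨p, hpK⟩ : K))
    exact (Submodule.eq_starProjection_of_mem_of_inner_eq_zero hpK
      ((K.norm_eq_iInf_iff_real_inner_eq_zero hpK).1 hinf)).symm

theorem existsUnique_isMinOn_weighted_norm_sq {X Y : Type*} [NormedAddCommGroup X]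
    [InnerProductSpace ℝ X] [CompleteSpace X] [NormedAddCommGroup Y] [InnerProductSpace ℝ Y]
    [CompleteSpace Y] {K : Submodule ℝ (X × Y)} (hK : IsClosed (K : Set (X × Y))) {a b : ℝ}
    (ha : 0 < a) (hb : 0 < b) (z : X × Y) :
    ∃! p, p ∈ K ∧ IsMinOn (fun q ↦ a * ‖q.1 - z.1‖ ^ 2 + b * ‖q.2 - z.2‖ ^ 2) K p := by
  let e : (X × Y) ≃L[ℝ] WithLp 2 (X × Y) :=
    ((ContinuousLinearEquiv.smulLeft (Units.mk0 √a (Real.sqrt_pos.2 ha).ne')).prodCongr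
      (ContinuousLinearEquiv.smulLeft (Units.mk0 √b (Real.sqrt_pos.2 hb).ne'))).trans
      (WithLp.prodContinuousLinearEquiv 2 ℝ X Y).symm
  have hnorm (q : X × Y) :
      a * ‖q.1 - z.1‖ ^ 2 + b * ‖q.2 - z.2‖ ^ 2 = ‖e z - e q‖ ^ 2 := by
    rw [← map_sub, WithLp.prod_norm_sq_eq_of_L2]
    change _ = ‖√a • (z.1 - q.1)‖ ^ 2 + ‖√b • (z.2 - q.2)‖ ^ 2
    rw [norm_smul, norm_smul, mul_pow, mul_pow, Real.norm_eq_abs, Real.norm_eq_abs, sq_abs, sq_abs,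
      Real.sq_sqrt ha.le, Real.sq_sqrt hb.le, norm_sub_rev z.1, norm_sub_rev z.2]
  have hclosed : IsClosed ((K.map e.toLinearMap : Submodule ℝ _) : Set (WithLp 2 (X × Y))) :=
    e.toHomeomorph.isClosed_image.2 hK
  have := hclosed.completeSpace_coe
  have hmin (p : X × Y) :
      IsMinOn (fun q ↦ ‖e z - q‖) (K.map e.toLinearMap : Submodule ℝ _) (e p) ↔
        IsMinOn (fun q ↦ a * ‖q.1 - z.1‖ ^ 2 + b * ‖q.2 - z.2‖ ^ 2) K p := by
    simp only [isMinOn_iff, SetLike.mem_coe, hnorm, Submodule.mem_map, forall_exists_index,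
      and_imp, forall_apply_eq_imp_iff₂, sq_le_sq₀ (norm_nonneg _) (norm_nonneg _)]
    rfl
  obtain ⟨_, ⟨⟨p, hpK, rfl⟩, hp⟩, huniq⟩ :=
    existsUnique_isMinOn_norm_sub (K.map e.toLinearMap) (e z)
  exact ⟨p, ⟨hpK, (hmin p).1 hp⟩, fun q ⟨hqK, hq⟩ ↦
    e.injective (huniq _ ⟨⟨q, hqK, rfl⟩, (hmin q).2 hq⟩)⟩

end WeightedProjection

section WeakGradient

variable {d : ℕ}

local notation "𝔼" => EuclideanSpace ℝ (Fin d)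

theorem support_gradient_subset (ψ : 𝔼 → ℝ) : Function.support (gradient ψ) ⊆ tsupport ψ := by
  refine Function.support_subset_iff'.2 fun x hx ↦ ?_
  rw [gradient, image_eq_zero_of_notMem_tsupport fun h ↦ hx (tsupport_fderiv_subset ℝ h), map_zero]

theorem continuous_gradient {ψ : 𝔼 → ℝ} (hψ : ContDiff ℝ 1 ψ) : Continuous (gradient ψ) :=
  (contDiff_gradient (m := 0) hψ (zero_add 1).le).continuous

theorem memLp_gradient {ψ : 𝔼 → ℝ} (hψ : ContDiff ℝ 1 ψ) (hψc : HasCompactSupport ψ) (p : ℝ≥0∞)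
    (μ : Measure 𝔼) [IsFiniteMeasureOnCompacts μ] : MemLp (gradient ψ) p μ :=
  (continuous_gradient hψ).memLp_of_hasCompactSupport (hψc.mono' (support_gradient_subset ψ))

theorem integral_smul_gradient {w ψ : 𝔼 → ℝ} (hw : ContDiff ℝ 1 w) (hψ : ContDiff ℝ 1 ψ)
    (hc : HasCompactSupport ψ) : ∫ x, w x • gradient ψ x = - ∫ x, ψ x • gradient w x := by
  have hwψ : Integrable fun x ↦ w x • gradient ψ x :=
    (hw.continuous.smul (continuous_gradient hψ)).integrable_of_hasCompactSupport
      (hc.mono' (support_gradient_subset ψ)).smul_left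
  have hψw : Integrable fun x ↦ ψ x • gradient w x :=
    (hψ.continuous.smul (continuous_gradient hw)).integrable_of_hasCompactSupport hc.smul_right
  refine ext_inner_left ℝ fun b ↦ ?_
  have hwψ_b : Integrable fun x ↦ w x * fderiv ℝ ψ x b := by
    simpa [inner_smul_right, inner_gradient_right] using hwψ.const_inner (𝕜 := ℝ) b
  have hψw_b : Integrable fun x ↦ fderiv ℝ w x b * ψ x := by
    simpa [inner_smul_right, inner_gradient_right, mul_comm] using hψw.const_inner (𝕜 := ℝ) b
  have hprod : Integrable fun x ↦ w x * ψ x :=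
    (hw.continuous.mul hψ.continuous).integrable_of_hasCompactSupport hc.mul_left
  rw [inner_neg_right, ← integral_inner hwψ, ← integral_inner hψw]
  simp_rw [inner_smul_right, inner_gradient_right, conj_trivial]
  rw [integral_mul_fderiv_eq_neg_fderiv_mul_of_integrable hψw_b hwψ_b hprod
    (fun x _ ↦ hw.differentiable one_ne_zero x) (fun x _ ↦ hψ.differentiable one_ne_zero x)]
  simp_rw [mul_comm]

theorem hasWeakGradient_of_contDiff {Ω : Set 𝔼} {w : 𝔼 → ℝ} (hw : ContDiff ℝ 1 w) :
    HasWeakGradient Ω w (gradient w) := by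
  refine ⟨hw.continuous.locallyIntegrable.locallyIntegrableOn Ω,
    (continuous_gradient hw).locallyIntegrable.locallyIntegrableOn Ω, fun ψ hψ hc hs ↦ ?_⟩
  have hψΩ (x) (hx : x ∉ Ω) : x ∉ tsupport ψ := fun h ↦ hx (hs h)
  rw [setIntegral_eq_integral_of_forall_compl_eq_zero fun x hx ↦ by
      rw [Function.notMem_support.1 fun h ↦ hψΩ x hx (support_gradient_subset ψ h), smul_zero],
    setIntegral_eq_integral_of_forall_compl_eq_zero fun x hx ↦ by
      rw [image_eq_zero_of_notMem_tsupport (hψΩ x hx), zero_smul]]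
  exact integral_smul_gradient hw (hψ.of_le (mod_cast le_top)) hc

theorem integrable_smul_of_locallyIntegrableOn {Ω : Set 𝔼} {F : Type*} [NormedAddCommGroup F]
    [NormedSpace ℝ F] {k : 𝔼 → F} (hk : LocallyIntegrableOn k Ω) {ψ : 𝔼 → ℝ} (hψ : Continuous ψ)
    (hc : HasCompactSupport ψ) (hs : tsupport ψ ⊆ Ω) : Integrable fun x ↦ ψ x • k x := by
  obtain ⟨C, hC⟩ := hc.exists_bound_of_continuous hψ
  refine (integrableOn_iff_integrable_of_support_subset
    ((Function.support_smul_subset_left ψ k).trans (subset_tsupport ψ))).1 ?_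
  exact (hk.integrableOn_compact_subset hs hc.isCompact).bdd_smul C hψ.aestronglyMeasurable
    (.of_forall hC)

theorem HasWeakGradient.ae_eq {Ω : Set 𝔼} {u : 𝔼 → ℝ} {g g' : 𝔼 → 𝔼} (hΩ : IsOpen Ω)
    (h : HasWeakGradient Ω u g) (h' : HasWeakGradient Ω u g') :
    g =ᵐ[volume.restrict Ω] g' := by
  have hsub := hΩ.ae_eq_zero_of_integral_contDiff_smul_eq_zero (h.2.1.sub h'.2.1)
    fun ψ hψ hc hs ↦ by
      have hset (k : 𝔼 → 𝔼) : ∫ x in Ω, ψ x • k x = ∫ x, ψ x • k x :=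
        setIntegral_eq_integral_of_forall_compl_eq_zero fun x hx ↦ by
          rw [image_eq_zero_of_notMem_tsupport fun hx' ↦ hx (hs hx'), zero_smul]
      have heq : ∫ x, ψ x • g x = ∫ x, ψ x • g' x := by
        rw [← hset, ← hset, ← neg_inj, ← h.2.2 ψ hψ hc hs, h'.2.2 ψ hψ hc hs]
      simp_rw [Pi.sub_apply, smul_sub]
      rw [integral_sub (integrable_smul_of_locallyIntegrableOn h.2.1 hψ.continuous hc hs)
        (integrable_smul_of_locallyIntegrableOn h'.2.1 hψ.continuous hc hs), heq, sub_self]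
  rw [Filter.EventuallyEq, ae_restrict_iff' hΩ.measurableSet]
  filter_upwards [hsub] with x hx hxΩ using sub_eq_zero.1 (hx hxΩ)

theorem HasWeakGradient.weakGradient_ae_eq {Ω : Set 𝔼} {u : 𝔼 → ℝ} {g : 𝔼 → 𝔼}
    (hΩ : IsOpen Ω) (h : HasWeakGradient Ω u g) : weakGradient Ω u =ᵐ[volume.restrict Ω] g := by
  have hex : ∃ g, HasWeakGradient Ω u g := ⟨g, h⟩
  rw [weakGradient, dif_pos hex]
  exact hex.choose_spec.ae_eq hΩ h

theorem MemH1.hasWeakGradient {Ω : Set 𝔼} {u : 𝔼 → ℝ} (h : MemH1 Ω u) :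
    HasWeakGradient Ω u (weakGradient Ω u) := by
  have hex : ∃ g, HasWeakGradient Ω u g := h.2.imp fun _ hg ↦ hg.1
  rw [weakGradient, dif_pos hex]
  exact hex.choose_spec

theorem MemH1.memLp_weakGradient {Ω : Set 𝔼} {u : 𝔼 → ℝ} (hΩ : IsOpen Ω) (h : MemH1 Ω u) :
    MemLp (weakGradient Ω u) 2 (volume.restrict Ω) := by
  obtain ⟨-, g, hg, hg2⟩ := h
  exact (memLp_congr_ae (hg.weakGradient_ae_eq hΩ)).2 hg2

theorem locallyIntegrableOn_of_memLp {Ω : Set 𝔼} {F : Type*} [NormedAddCommGroup F]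
    {p : ℝ≥0∞} (hp : 1 ≤ p) {k : 𝔼 → F} (hk : MemLp k p (volume.restrict Ω)) :
    LocallyIntegrableOn k Ω :=
  locallyIntegrableOn_of_locallyIntegrable_restrict (hk.locallyIntegrable hp)

end WeakGradient

section QuadraticEnergy

variable {d : ℕ}

local notation "𝔼" => EuclideanSpace ℝ (Fin d)

/-- The strictly convex energy `a ‖u - u₀‖² + b ‖∇u‖²` in `L²(Ω)`, for `u` in `H¹(Ω)`. A
convex-concave splitting step from `u₀` minimizes it, up to an additive constant. -/
noncomputable def quadraticEnergy (Ω : Set 𝔼) (a b : ℝ) (u₀ u : 𝔼 → ℝ) : ℝ :=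
  a * (∫ x in Ω, (u x - u₀ x) ^ 2) + b * ∫ x in Ω, ‖weakGradient Ω u x‖ ^ 2

theorem norm_toLp_sq {α F : Type*} [MeasurableSpace α] {μ : Measure α} [NormedAddCommGroup F]
    [InnerProductSpace ℝ F] {k : α → F} (hk : MemLp k 2 μ) :
    ‖hk.toLp‖ ^ 2 = ∫ x, ‖k x‖ ^ 2 ∂μ := by
  rw [← real_inner_self_eq_norm_sq, L2.inner_def]
  refine integral_congr_ae ?_
  filter_upwards [hk.coeFn_toLp] with x hx
  rw [hx, real_inner_self_eq_norm_sq]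

theorem lpPairing_lsmul_toLp {α F : Type*} [MeasurableSpace α] {μ : Measure α}
    [NormedAddCommGroup F] [NormedSpace ℝ F] [CompleteSpace F] {k : α → ℝ} {l : α → F}
    (hk : MemLp k 2 μ) (hl : MemLp l 2 μ) :
    (ContinuousLinearMap.lsmul ℝ ℝ : ℝ →L[ℝ] F →L[ℝ] F).lpPairing μ 2 2 hk.toLp hl.toLp =
      ∫ x, k x • l x ∂μ := by
  rw [ContinuousLinearMap.lpPairing_eq_integral]
  refine integral_congr_ae ?_
  filter_upwards [hk.coeFn_toLp, hl.coeFn_toLp] with x hkx hlx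
  rw [hkx, hlx, ContinuousLinearMap.lsmul_apply]

/-- The graph of the weak gradient on `Ω`, as a subspace of `L²(Ω) × L²(Ω; ℝᵈ)`; this is `H¹(Ω)`
with functions identified when they agree almost everywhere. -/
noncomputable def weakGradientGraph (Ω : Set 𝔼) :
    Submodule ℝ (Lp ℝ 2 (volume.restrict Ω) × Lp 𝔼 2 (volume.restrict Ω)) :=
  ⨅ (ψ : 𝔼 → ℝ) (hψ : ContDiff ℝ ∞ ψ) (hc : HasCompactSupport ψ) (_ : tsupport ψ ⊆ Ω),
    (((ContinuousLinearMap.lsmul ℝ ℝ : ℝ →L[ℝ] 𝔼 →L[ℝ] 𝔼).lpPairing (volume.restrict Ω) 2 2).flip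
        (memLp_gradient (hψ.of_le (mod_cast le_top)) hc 2 _).toLp
      |>.coprod <|
      (ContinuousLinearMap.lsmul ℝ ℝ : ℝ →L[ℝ] 𝔼 →L[ℝ] 𝔼).lpPairing (volume.restrict Ω) 2 2
        (hψ.continuous.memLp_of_hasCompactSupport hc).toLp).ker

theorem isClosed_weakGradientGraph {Ω : Set 𝔼} :
    IsClosed (X := Lp ℝ 2 (volume.restrict Ω) × Lp 𝔼 2 (volume.restrict Ω))
      (weakGradientGraph Ω) := by
  simp only [weakGradientGraph, Submodule.coe_iInf]
  exact isClosed_iInter fun ψ ↦ isClosed_iInter fun hψ ↦ isClosed_iInter fun hc ↦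
    isClosed_iInter fun _ ↦ ContinuousLinearMap.isClosed_ker _

theorem toLp_mem_weakGradientGraph {Ω : Set 𝔼} {u : 𝔼 → ℝ} {g : 𝔼 → 𝔼}
    (hu : MemLp u 2 (volume.restrict Ω)) (hg : MemLp g 2 (volume.restrict Ω)) :
    (hu.toLp, hg.toLp) ∈ weakGradientGraph Ω ↔ HasWeakGradient Ω u g := by
  simp [weakGradientGraph, HasWeakGradient, locallyIntegrableOn_of_memLp one_le_two hu,
    locallyIntegrableOn_of_memLp one_le_two hg, lpPairing_lsmul_toLp, add_eq_zero_iff_eq_neg]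

theorem quadraticEnergy_eq_norm_toLp {Ω : Set 𝔼} {a b : ℝ} {u₀ u : 𝔼 → ℝ} {g : 𝔼 → 𝔼}
    (hΩ : IsOpen Ω) (hu₀ : MemLp u₀ 2 (volume.restrict Ω)) (hu : MemLp u 2 (volume.restrict Ω))
    (hg : MemLp g 2 (volume.restrict Ω)) (h : HasWeakGradient Ω u g) :
    quadraticEnergy Ω a b u₀ u = a * ‖hu.toLp - hu₀.toLp‖ ^ 2 + b * ‖hg.toLp‖ ^ 2 := by
  have hgrad : ∫ x in Ω, ‖weakGradient Ω u x‖ ^ 2 = ∫ x in Ω, ‖g x‖ ^ 2 := by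
    refine integral_congr_ae ?_
    filter_upwards [h.weakGradient_ae_eq hΩ] with x hx
    rw [hx]
  rw [quadraticEnergy, hgrad, ← MemLp.toLp_sub, norm_toLp_sq, norm_toLp_sq]
  simp only [Pi.sub_apply, Real.norm_eq_abs, sq_abs]

theorem isMinOn_quadraticEnergy_iff {Ω : Set 𝔼} {a b : ℝ} {u₀ u : 𝔼 → ℝ} {g : 𝔼 → 𝔼}
    (hΩ : IsOpen Ω) (hu₀ : MemLp u₀ 2 (volume.restrict Ω)) (hu : MemLp u 2 (volume.restrict Ω))
    (hg : MemLp g 2 (volume.restrict Ω)) (h : HasWeakGradient Ω u g) :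
    IsMinOn (quadraticEnergy Ω a b u₀) {w | MemH1 Ω w} u ↔
      IsMinOn (fun q ↦ a * ‖q.1 - hu₀.toLp‖ ^ 2 + b * ‖q.2 - 0‖ ^ 2)
        (weakGradientGraph Ω) (hu.toLp, hg.toLp) := by
  simp only [isMinOn_iff, sub_zero, quadraticEnergy_eq_norm_toLp hΩ hu₀ hu hg h]
  refine ⟨fun hmin q hq ↦ ?_, fun hmin w hw ↦ ?_⟩
  · have hgraph : HasWeakGradient Ω q.1 q.2 :=
      (toLp_mem_weakGradientGraph (Lp.memLp q.1) (Lp.memLp q.2)).1 (by simpa using hq)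
    simpa [quadraticEnergy_eq_norm_toLp hΩ hu₀ (Lp.memLp q.1) (Lp.memLp q.2) hgraph] using
      hmin q.1 ⟨Lp.memLp q.1, q.2, hgraph, Lp.memLp q.2⟩
  · have hw' : MemH1 Ω w := hw
    rw [quadraticEnergy_eq_norm_toLp hΩ hu₀ hw'.1 (hw'.memLp_weakGradient hΩ) hw'.hasWeakGradient]
    have hq := (toLp_mem_weakGradientGraph hw'.1 (hw'.memLp_weakGradient hΩ)).2
      hw'.hasWeakGradient
    simpa only using hmin _ hq

theorem exists_isMinOn_quadraticEnergy {Ω : Set 𝔼} {a b : ℝ} {u₀ : 𝔼 → ℝ} (hΩ : IsOpen Ω)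
    (ha : 0 < a) (hb : 0 < b) (hu₀ : MemLp u₀ 2 (volume.restrict Ω)) :
    ∃ u, MemH1 Ω u ∧ IsMinOn (quadraticEnergy Ω a b u₀) {w | MemH1 Ω w} u := by
  obtain ⟨p, ⟨hp, hmin⟩, -⟩ := existsUnique_isMinOn_weighted_norm_sq
    (isClosed_weakGradientGraph (Ω := Ω)) ha hb (hu₀.toLp, 0)
  have hgraph : HasWeakGradient Ω p.1 p.2 :=
    (toLp_mem_weakGradientGraph (Lp.memLp p.1) (Lp.memLp p.2)).1 (by simpa using hp)
  exact ⟨p.1, ⟨Lp.memLp p.1, p.2, hgraph, Lp.memLp p.2⟩,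
    (isMinOn_quadraticEnergy_iff hΩ hu₀ (Lp.memLp p.1) (Lp.memLp p.2) hgraph).2
      (by simpa using hmin)⟩

theorem ae_eq_of_isMinOn_quadraticEnergy {Ω : Set 𝔼} {a b : ℝ} {u₀ u u' : 𝔼 → ℝ}
    (hΩ : IsOpen Ω) (ha : 0 < a) (hb : 0 < b) (hu₀ : MemLp u₀ 2 (volume.restrict Ω))
    (hu : MemH1 Ω u) (hu' : MemH1 Ω u')
    (hmin : IsMinOn (quadraticEnergy Ω a b u₀) {w | MemH1 Ω w} u)
    (hmin' : IsMinOn (quadraticEnergy Ω a b u₀) {w | MemH1 Ω w} u') :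
    u =ᵐ[volume.restrict Ω] u' := by
  have hlift {w : 𝔼 → ℝ} (hw : MemH1 Ω w)
      (hwmin : IsMinOn (quadraticEnergy Ω a b u₀) {w | MemH1 Ω w} w) :=
    And.intro ((toLp_mem_weakGradientGraph hw.1 (hw.memLp_weakGradient hΩ)).2 hw.hasWeakGradient)
      ((isMinOn_quadraticEnergy_iff hΩ hu₀ hw.1 (hw.memLp_weakGradient hΩ)
        hw.hasWeakGradient).1 hwmin)
  have heq := (existsUnique_isMinOn_weighted_norm_sq
    (isClosed_weakGradientGraph (Ω := Ω)) ha hb (hu₀.toLp, 0)).unique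
    (hlift hu hmin) (hlift hu' hmin')
  exact (MemLp.toLp_eq_toLp_iff hu.1 hu'.1).1 (Prod.ext_iff.1 heq).1

end QuadraticEnergy

section Competitor

open Filter

variable {d : ℕ}

local notation "𝔼" => EuclideanSpace ℝ (Fin d)

theorem sq_add_le_mul_sq_add {θ : ℝ} (hθ : 0 < θ) (p q : ℝ) :
    (p + q) ^ 2 ≤ (1 + θ) * p ^ 2 + (1 + θ⁻¹) * q ^ 2 := by
  have hdiff : (1 + θ) * p ^ 2 + (1 + θ⁻¹) * q ^ 2 - (p + q) ^ 2 = θ⁻¹ * (θ * p - q) ^ 2 := by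
    field_simp
    ring
  exact sub_nonneg.1 (hdiff ▸ by positivity)

theorem exists_schwartzMap_integral_sq_sub_add_le {k c P : ℝ} (hk : 0 < k) (hc : 0 < c)
    {f : 𝓢(𝔼, ℝ)} (hfc : HasCompactSupport f) (hf : ∀ x y, f x - f y ≤ c)
    (hP : VariationLE f P) :
    ∃ v : 𝓢(𝔼, ℝ), ∫ x, (k ^ 2 * (v x - f x) ^ 2 + ‖gradient v x‖ ^ 2) ≤ k * c / 2 * P := by
  obtain ⟨v, hv⟩ := exists_laplacian_eq_sq_mul_sub hk.ne' f
  refine ⟨v, (integral_sq_sub_add_norm_gradient_sq hv).trans_le ?_⟩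
  simp_rw [SchwartzMap.laplacian_apply] at hv ⊢
  exact hP.neg_integral_mul_laplacian_le hfc (v.smooth 2) (by positivity)
    (norm_gradient_le_of_laplacian_eq hk (v.smooth 2) (zero_at_infty v) hv hf)

theorem memLp_indicator_one {V : Set 𝔼} (hV : MeasurableSet V) (hVb : Bornology.IsBounded V)
    (p : ℝ≥0∞) : MemLp (V.indicator (1 : 𝔼 → ℝ)) p :=
  memLp_indicator_const p hV (1 : ℝ) (.inr hVb.measure_lt_top.ne)

theorem integrable_mul_sq_sub_add_norm_gradient_sq {h : 𝔼 → ℝ} (hh : MemLp h 2) (c : ℝ)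
    (v : 𝓢(𝔼, ℝ)) : Integrable fun x ↦ c * (v x - h x) ^ 2 + ‖gradient v x‖ ^ 2 :=
  (((v.memLp 2).sub hh).integrable_sq.const_mul c).add (integrable_norm_gradient_sq v)

theorem exists_schwartzMap_integral_sq_sub_indicator_add_le {V : Set 𝔼} (hV : MeasurableSet V)
    (hVb : Bornology.IsBounded V) (hP : perimeter V ≠ ⊤) {k θ : ℝ} (hk : 0 < k) (hθ : 0 < θ) :
    ∃ v : 𝓢(𝔼, ℝ), ∫ x, (k ^ 2 * (v x - V.indicator 1 x) ^ 2 + ‖gradient v x‖ ^ 2) ≤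
      (1 + θ) * (k / 2 * (perimeter V).toReal + k ^ 2 * θ) := by
  obtain ⟨f₀, hf, hfc, hosc, hδ, hvar⟩ := exists_contDiff_variationLE hV hVb hP (sq_pos_of_pos hθ)
  let f : 𝓢(𝔼, ℝ) := hfc.toSchwartzMap hf
  obtain ⟨v, hv⟩ := exists_schwartzMap_integral_sq_sub_add_le (f := f) hk one_pos hfc hosc hvar
  have hχ := memLp_indicator_one hV hVb 2
  have hv_int := integrable_mul_sq_sub_add_norm_gradient_sq (f.memLp 2) (k ^ 2) v
  have hf_int : Integrable fun x ↦ (f x - V.indicator 1 x) ^ 2 :=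
    ((f.memLp 2).sub hχ).integrable_sq
  have hle (x : 𝔼) : k ^ 2 * (v x - V.indicator 1 x) ^ 2 + ‖gradient v x‖ ^ 2 ≤
      (1 + θ) * (k ^ 2 * (v x - f x) ^ 2 + ‖gradient v x‖ ^ 2) +
        k ^ 2 * (1 + θ⁻¹) * (f x - V.indicator 1 x) ^ 2 := by
    have hsq := mul_le_mul_of_nonneg_left
      (sq_add_le_mul_sq_add hθ (v x - f x) (f x - V.indicator 1 x)) (sq_nonneg k)
    have hgrad : 0 ≤ θ * ‖gradient v x‖ ^ 2 := by positivity
    rw [sub_add_sub_cancel] at hsq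
    linarith
  refine ⟨v, ?_⟩
  calc ∫ x, (k ^ 2 * (v x - V.indicator 1 x) ^ 2 + ‖gradient v x‖ ^ 2)
      ≤ ∫ x, ((1 + θ) * (k ^ 2 * (v x - f x) ^ 2 + ‖gradient v x‖ ^ 2) +
          k ^ 2 * (1 + θ⁻¹) * (f x - V.indicator 1 x) ^ 2) :=
        integral_mono (integrable_mul_sq_sub_add_norm_gradient_sq hχ _ v)
          ((hv_int.const_mul _).add (hf_int.const_mul _)) hle
    _ = (1 + θ) * (∫ x, (k ^ 2 * (v x - f x) ^ 2 + ‖gradient v x‖ ^ 2)) +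
          k ^ 2 * (1 + θ⁻¹) * ∫ x, (f x - V.indicator 1 x) ^ 2 := by
        rw [integral_add (hv_int.const_mul _) (hf_int.const_mul _), integral_const_mul,
          integral_const_mul]
    _ ≤ (1 + θ) * (k * 1 / 2 * (perimeter V).toReal) + k ^ 2 * (1 + θ⁻¹) * θ ^ 2 := by
        gcongr
        exact hδ.le
    _ = (1 + θ) * (k / 2 * (perimeter V).toReal + k ^ 2 * θ) := by
        field_simp
        ring

theorem sharpInterface_eq (V : Set 𝔼) (x : 𝔼) :
    sharpInterface V x = 2 * V.indicator 1 x - 1 := by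
  by_cases hx : x ∈ V <;> norm_num [sharpInterface, hx]

theorem memLp_sharpInterface {Ω V : Set 𝔼} (hΩvol : volume Ω < ⊤) (hV : MeasurableSet V)
    (p : ℝ≥0∞) : MemLp (sharpInterface V) p (volume.restrict Ω) := by
  have : IsFiniteMeasure (volume.restrict Ω) := ⟨by simpa using hΩvol⟩
  exact ((memLp_const (1 : ℝ)).indicator hV).sub ((memLp_const (1 : ℝ)).indicator hV.compl)

theorem gradient_const_mul_sub_const {E : Type*} [NormedAddCommGroup E] [InnerProductSpace ℝ E]
    [CompleteSpace E] {v : E → ℝ} (hv : Differentiable ℝ v) (c e : ℝ) :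
    gradient (fun x ↦ c * v x - e) = c • gradient v := by
  ext1 x
  simp [gradient, fderiv_sub_const, fderiv_const_mul (hv x)]

theorem memLp_gradient_schwartzMap (v : 𝓢(𝔼, ℝ)) : MemLp (gradient v) 2 :=
  (memLp_two_iff_integrable_sq_norm (continuous_gradient (v.smooth 1)).aestronglyMeasurable).2
    (integrable_norm_gradient_sq v)

theorem contDiff_const_mul_schwartzMap_sub_const (c e : ℝ) (v : 𝓢(𝔼, ℝ)) :
    ContDiff ℝ 1 fun x ↦ c * v x - e :=
  (contDiff_const.mul (v.smooth 1)).sub contDiff_const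

theorem memH1_const_mul_schwartzMap_sub_const {Ω : Set 𝔼} (hΩvol : volume Ω < ⊤) (c e : ℝ)
    (v : 𝓢(𝔼, ℝ)) : MemH1 Ω fun x ↦ c * v x - e := by
  have : IsFiniteMeasure (volume.restrict Ω) := ⟨by simpa using hΩvol⟩
  refine ⟨(((v.memLp 2).restrict Ω).const_mul c).sub (memLp_const e), _,
    hasWeakGradient_of_contDiff (contDiff_const_mul_schwartzMap_sub_const c e v), ?_⟩
  rw [gradient_const_mul_sub_const v.differentiable]
  exact ((memLp_gradient_schwartzMap v).restrict Ω).const_smul c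

theorem quadraticEnergy_sharpInterface_le {Ω V : Set 𝔼} (hΩ : IsOpen Ω) (hV : MeasurableSet V)
    (hVb : Bornology.IsBounded V) {b : ℝ} (hb : 0 ≤ b) (k : ℝ) (v : 𝓢(𝔼, ℝ)) :
    quadraticEnergy Ω (b * k ^ 2) b (sharpInterface V) (fun x ↦ 2 * v x - 1) ≤
      4 * b * ∫ x, (k ^ 2 * (v x - V.indicator 1 x) ^ 2 + ‖gradient v x‖ ^ 2) := by
  have hχ_int : Integrable fun x ↦ (v x - V.indicator 1 x) ^ 2 :=
    ((v.memLp 2).sub (memLp_indicator_one hV hVb 2)).integrable_sq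
  have hgrad_int := integrable_norm_gradient_sq v
  have hw := (hasWeakGradient_of_contDiff
    (contDiff_const_mul_schwartzMap_sub_const 2 1 v)).weakGradient_ae_eq hΩ
  rw [gradient_const_mul_sub_const v.differentiable] at hw
  have hgrad : ∫ x in Ω, ‖weakGradient Ω (fun x ↦ 2 * v x - 1) x‖ ^ 2 =
      4 * ∫ x in Ω, ‖gradient v x‖ ^ 2 := by
    rw [← integral_const_mul]
    refine integral_congr_ae ?_
    filter_upwards [hw] with x hx
    rw [hx, Pi.smul_apply, norm_smul, mul_pow]
    norm_num
  have hdiff : ∫ x in Ω, (2 * v x - 1 - sharpInterface V x) ^ 2 =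
      4 * ∫ x in Ω, (v x - V.indicator 1 x) ^ 2 := by
    rw [← integral_const_mul]
    congr 1 with x
    rw [sharpInterface_eq]
    ring
  calc quadraticEnergy Ω (b * k ^ 2) b (sharpInterface V) (fun x ↦ 2 * v x - 1)
      = 4 * b * ∫ x in Ω, (k ^ 2 * (v x - V.indicator 1 x) ^ 2 + ‖gradient v x‖ ^ 2) := by
        rw [quadraticEnergy, hdiff, hgrad, integral_add (hχ_int.const_mul _).integrableOn
          hgrad_int.integrableOn, integral_const_mul]
        ring
    _ ≤ 4 * b * ∫ x, (k ^ 2 * (v x - V.indicator 1 x) ^ 2 + ‖gradient v x‖ ^ 2) := by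
        refine mul_le_mul_of_nonneg_left (setIntegral_le_integral
          ((hχ_int.const_mul _).add hgrad_int) (.of_forall fun x ↦ ?_)) (by positivity)
        simp only [Pi.zero_apply]
        positivity

theorem quadraticEnergy_le_of_isMinOn {Ω V : Set 𝔼} (hΩ : IsOpen Ω) (hΩvol : volume Ω < ⊤)
    (hV : MeasurableSet V) (hVb : Bornology.IsBounded V) (hP : perimeter V ≠ ⊤) {b k : ℝ}
    (hb : 0 ≤ b) (hk : 0 < k) {u : 𝔼 → ℝ}
    (hmin : IsMinOn (quadraticEnergy Ω (b * k ^ 2) b (sharpInterface V)) {w | MemH1 Ω w} u) :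
    quadraticEnergy Ω (b * k ^ 2) b (sharpInterface V) u ≤ 2 * b * k * (perimeter V).toReal := by
  have hlim : Tendsto
      (fun θ : ℝ ↦ 4 * b * ((1 + θ) * (k / 2 * (perimeter V).toReal + k ^ 2 * θ)))
      (𝓝[>] 0) (𝓝 (2 * b * k * (perimeter V).toReal)) := by
    refine tendsto_nhdsWithin_of_tendsto_nhds (Continuous.tendsto' (by fun_prop) _ _ ?_)
    ring
  refine ge_of_tendsto hlim (eventually_mem_nhdsWithin.mono fun θ hθ ↦ ?_)
  obtain ⟨v, hv⟩ := exists_schwartzMap_integral_sq_sub_indicator_add_le hV hVb hP hk hθ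
  calc quadraticEnergy Ω (b * k ^ 2) b (sharpInterface V) u
      ≤ quadraticEnergy Ω (b * k ^ 2) b (sharpInterface V) (fun x ↦ 2 * v x - 1) :=
        hmin (memH1_const_mul_schwartzMap_sub_const hΩvol 2 1 v)
    _ ≤ 4 * b * ∫ x, (k ^ 2 * (v x - V.indicator 1 x) ^ 2 + ‖gradient v x‖ ^ 2) :=
        quadraticEnergy_sharpInterface_le hΩ hV hVb hb k v
    _ ≤ 4 * b * ((1 + θ) * (k / 2 * (perimeter V).toReal + k ^ 2 * θ)) := by gcongr

end Competitor

section SplittingStep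

variable {d : ℕ}

local notation "𝔼" => EuclideanSpace ℝ (Fin d)

theorem stepFunctional_eq {Ω : Set 𝔼} (hΩ : IsOpen Ω) {Wconc : ℝ → ℝ} (ε τ : ℝ) {u₀ u : 𝔼 → ℝ}
    (hu₀ : MemLp u₀ 2 (volume.restrict Ω)) (hderiv : ∀ x, deriv Wconc (u₀ x) = -2 * u₀ x)
    (hu : MemH1 Ω u) : stepFunctional Ω Wconc ε τ u₀ u =
      quadraticEnergy Ω (1 / (2 * τ) + 1 / ε) (ε / 2) u₀ u - 1 / ε * ∫ x in Ω, u₀ x ^ 2 := by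
  have hdiff_int : Integrable (fun x ↦ (u x - u₀ x) ^ 2) (volume.restrict Ω) :=
    (hu.1.sub hu₀).integrable_sq
  have hgrad_int : Integrable (fun x ↦ ‖weakGradient Ω u x‖ ^ 2) (volume.restrict Ω) :=
    (hu.memLp_weakGradient hΩ).integrable_norm_pow two_ne_zero
  have hsq (x : 𝔼) : ε / 2 * ‖weakGradient Ω u x‖ ^ 2
        + (u x ^ 2 + deriv Wconc (u₀ x) * u x) / ε =
      ε / 2 * ‖weakGradient Ω u x‖ ^ 2 + 1 / ε * (u x - u₀ x) ^ 2 - 1 / ε * u₀ x ^ 2 := by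
    rw [hderiv]
    ring
  simp_rw [stepFunctional, hsq]
  rw [integral_sub ((hgrad_int.const_mul _).fun_add (hdiff_int.const_mul _))
    (hu₀.integrable_sq.const_mul _), integral_add (hgrad_int.const_mul _) (hdiff_int.const_mul _),
    integral_const_mul, integral_const_mul, integral_const_mul, quadraticEnergy]
  ring

theorem isSplittingStep_iff {Ω : Set 𝔼} (hΩ : IsOpen Ω) {Wconc : ℝ → ℝ} {ε τ : ℝ} {u₀ u : 𝔼 → ℝ}
    (hu₀ : MemLp u₀ 2 (volume.restrict Ω)) (hderiv : ∀ x, deriv Wconc (u₀ x) = -2 * u₀ x) :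
    IsSplittingStep Ω Wconc ε τ u₀ u ↔ MemH1 Ω u ∧
      IsMinOn (quadraticEnergy Ω (1 / (2 * τ) + 1 / ε) (ε / 2) u₀) {w | MemH1 Ω w} u := by
  refine and_congr_right fun hu ↦ isMinOn_iff.trans ?_ |>.symm
  refine forall₂_congr fun w hw ↦ ?_
  rw [stepFunctional_eq hΩ ε τ hu₀ hderiv hu, stepFunctional_eq hΩ ε τ hu₀ hderiv hw,
    sub_le_sub_iff_right]

theorem energy_le_ofReal_quadraticEnergy {Ω : Set 𝔼} (hΩ : IsOpen Ω) {W : ℝ → ℝ} {ε a : ℝ}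
    (hε : 0 < ε) (ha : 1 / ε ≤ a) {u₀ u : 𝔼 → ℝ} (hu₀ : MemLp u₀ 2 (volume.restrict Ω))
    (hW : ∀ x t, W t ≤ (t - u₀ x) ^ 2) (hu : MemH1 Ω u) :
    energy Ω W ε u ≤ ENNReal.ofReal (quadraticEnergy Ω a (ε / 2) u₀ u) := by
  have ha0 : 0 ≤ a := (one_div_pos.2 hε).le.trans ha
  have hdiff_int : Integrable (fun x ↦ a * (u x - u₀ x) ^ 2) (volume.restrict Ω) :=
    (hu.1.sub hu₀).integrable_sq.const_mul a
  have hgrad_int : Integrable (fun x ↦ ε / 2 * ‖weakGradient Ω u x‖ ^ 2) (volume.restrict Ω) :=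
    ((hu.memLp_weakGradient hΩ).integrable_norm_pow two_ne_zero).const_mul _
  have hle (x : 𝔼) : ε / 2 * ‖weakGradient Ω u x‖ ^ 2 + W (u x) / ε ≤
      a * (u x - u₀ x) ^ 2 + ε / 2 * ‖weakGradient Ω u x‖ ^ 2 :=
    calc ε / 2 * ‖weakGradient Ω u x‖ ^ 2 + W (u x) / ε
        ≤ ε / 2 * ‖weakGradient Ω u x‖ ^ 2 + (u x - u₀ x) ^ 2 / ε := by gcongr; exact hW x (u x)
      _ = 1 / ε * (u x - u₀ x) ^ 2 + ε / 2 * ‖weakGradient Ω u x‖ ^ 2 := by ring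
      _ ≤ a * (u x - u₀ x) ^ 2 + ε / 2 * ‖weakGradient Ω u x‖ ^ 2 := by gcongr
  rw [quadraticEnergy, ← integral_const_mul, ← integral_const_mul,
    ← integral_add hdiff_int hgrad_int,
    ofReal_integral_eq_lintegral_ofReal (hdiff_int.fun_add hgrad_int)
      (.of_forall fun x ↦ by simp only [Pi.zero_apply]; positivity)]
  exact lintegral_mono fun x ↦ ENNReal.ofReal_le_ofReal (hle x)

theorem apply_sharpInterface_eq_zero {W : ℝ → ℝ} (hone : W 1 = 0) (hnegone : W (-1) = 0)
    (V : Set 𝔼) (x : 𝔼) : W (sharpInterface V x) = 0 := by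
  by_cases hx : x ∈ V <;> simp [sharpInterface, hx, hone, hnegone]

theorem sqrt_two_add_le {r : ℝ} (hr : 0 ≤ r) : √(2 + r) ≤ √2 + r := by
  refine Real.sqrt_le_iff.2 ⟨by positivity, ?_⟩
  have hsqrt : 1 ≤ √2 := Real.one_le_sqrt.2 one_le_two
  nlinarith [Real.sq_sqrt (zero_le_two (α := ℝ)), mul_le_mul_of_nonneg_right hsqrt hr]

theorem quadraticEnergy_le_sqrt_mul_perimeter {Ω V : Set 𝔼} (hΩ : IsOpen Ω)
    (hΩvol : volume Ω < ⊤) (hV : MeasurableSet V) (hVb : Bornology.IsBounded V)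
    (hP : perimeter V ≠ ⊤) {ε τ : ℝ} (hε : 0 < ε) (hτ : 0 < τ) {u : 𝔼 → ℝ}
    (hmin : IsMinOn (quadraticEnergy Ω (1 / (2 * τ) + 1 / ε) (ε / 2) (sharpInterface V))
      {w | MemH1 Ω w} u) :
    quadraticEnergy Ω (1 / (2 * τ) + 1 / ε) (ε / 2) (sharpInterface V) u ≤
      √(2 + ε / τ) * (perimeter V).toReal := by
  have hcoeff : ε / 2 * (√(2 + ε / τ) / ε) ^ 2 = 1 / (2 * τ) + 1 / ε := by
    rw [div_pow, Real.sq_sqrt (by positivity)]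
    field_simp
    ring
  rw [← hcoeff] at hmin ⊢
  refine (quadraticEnergy_le_of_isMinOn hΩ hΩvol hV hVb hP (half_pos hε).le (by positivity)
    hmin).trans_eq ?_
  field_simp

theorem energy_le_of_isMinOn {Ω V : Set 𝔼} (hΩ : IsOpen Ω) (hΩvol : volume Ω < ⊤)
    (hV : MeasurableSet V) (hVb : Bornology.IsBounded V) {W : ℝ → ℝ}
    (hW : ∀ x t, W t ≤ (t - sharpInterface V x) ^ 2) {ε τ : ℝ} (hε : 0 < ε) (hτ : 0 < τ)
    {u : 𝔼 → ℝ} (hu : MemH1 Ω u)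
    (hmin : IsMinOn (quadraticEnergy Ω (1 / (2 * τ) + 1 / ε) (ε / 2) (sharpInterface V))
      {w | MemH1 Ω w} u) :
    energy Ω W ε u ≤ ENNReal.ofReal (√2 + ε / τ) * perimeter V := by
  by_cases hP : perimeter V = ⊤
  · rw [hP, ENNReal.mul_top (ENNReal.ofReal_pos.2 (by positivity)).ne']
    exact le_top
  calc energy Ω W ε u
      ≤ ENNReal.ofReal
          (quadraticEnergy Ω (1 / (2 * τ) + 1 / ε) (ε / 2) (sharpInterface V) u) :=
        energy_le_ofReal_quadraticEnergy hΩ hε (le_add_of_nonneg_left (by positivity))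
          (memLp_sharpInterface hΩvol hV 2) hW hu
    _ ≤ ENNReal.ofReal (√(2 + ε / τ) * (perimeter V).toReal) :=
        ENNReal.ofReal_le_ofReal
          (quadraticEnergy_le_sqrt_mul_perimeter hΩ hΩvol hV hVb hP hε hτ hmin)
    _ = ENNReal.ofReal √(2 + ε / τ) * perimeter V := by
        rw [ENNReal.ofReal_mul (Real.sqrt_nonneg _), ENNReal.ofReal_toReal hP]
    _ ≤ ENNReal.ofReal (√2 + ε / τ) * perimeter V := by
        gcongr
        exact sqrt_two_add_le (by positivity)

end SplittingStep

end SharpInterface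

open SharpInterface in
theorem mainTheorem4_general {d : ℕ}
    {W Wconc : ℝ → ℝ} (hW : ∀ s, W s = s ^ 2 + Wconc s)
    (hconc : ConcaveOn ℝ univ Wconc)
    (hWnonneg : ∀ s, 0 ≤ W s) (hWone : W 1 = 0) (hWnegone : W (-1) = 0)
    {Ω : Set (EuclideanSpace ℝ (Fin d))} (hΩ : IsOpen Ω) (hΩvol : volume Ω < ⊤)
    {V : Set (EuclideanSpace ℝ (Fin d))} (hV : MeasurableSet V) (hVb : Bornology.IsBounded V)
    {ε τ : ℝ} (hε : 0 < ε) (hτ : 0 < τ) :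
    (∃ u₁, IsSplittingStep Ω Wconc ε τ (sharpInterface V) u₁) ∧
    (∀ u₁ u₁', IsSplittingStep Ω Wconc ε τ (sharpInterface V) u₁ →
      IsSplittingStep Ω Wconc ε τ (sharpInterface V) u₁' → u₁ =ᵐ[volume.restrict Ω] u₁') ∧
    (∀ u₁, IsSplittingStep Ω Wconc ε τ (sharpInterface V) u₁ →
      energy Ω W ε u₁ ≤ ENNReal.ofReal (√2 + ε / τ) * perimeter V ∧
      (ε ≤ τ → energy Ω W ε u₁ ≤ ENNReal.ofReal (√2 + 1) * perimeter V)) := by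
  have hW₀ (x) : W (sharpInterface V x) = 0 := apply_sharpInterface_eq_zero hWone hWnegone V x
  have hu₀ := memLp_sharpInterface hΩvol hV 2
  have ha : 0 < 1 / (2 * τ) + 1 / ε := by positivity
  simp only [isSplittingStep_iff hΩ hu₀ fun x ↦
    (hasDerivAt_of_potential hW hconc hWnonneg (hW₀ x)).deriv]
  refine ⟨exists_isMinOn_quadraticEnergy hΩ ha (half_pos hε) hu₀, fun u u' hu hu' ↦
    ae_eq_of_isMinOn_quadraticEnergy hΩ ha (half_pos hε) hu₀ hu.1 hu'.1 hu.2 hu'.2, fun u hu ↦ ?_⟩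
  have henergy := energy_le_of_isMinOn hΩ hΩvol hV hVb
    (fun x ↦ potential_le_sq hW hconc hWnonneg (hW₀ x)) hε hτ hu.1 hu.2
  refine ⟨henergy, fun hετ ↦ henergy.trans ?_⟩
  gcongr
  exact (div_le_one hτ).2 hετ

theorem mainTheorem4 {d : ℕ} (hd : 0 < d)
    (W Wconc : ℝ → ℝ) (hW : ∀ s, W s = s ^ 2 + Wconc s)
    (hconc : ConcaveOn ℝ univ Wconc) (hC1 : ContDiff ℝ 1 Wconc)
    (hWnonneg : ∀ s, 0 ≤ W s) (hWone : W 1 = 0) (hWnegone : W (-1) = 0)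
    (Ω : Set (EuclideanSpace ℝ (Fin d))) (hΩ : IsOpen Ω) (hΩvol : volume Ω < ⊤)
    (V : Set (EuclideanSpace ℝ (Fin d))) (hV : IsOpen V)
    (hVcompact : IsCompact (closure V)) (hVΩ : closure V ⊆ Ω)
    (hVbdry : SharpInterface.HasC2Boundary V)
    (ε τ : ℝ) (hε : 0 < ε) (hτ : 0 < τ) :
    (∃ u₁, SharpInterface.IsSplittingStep Ω Wconc ε τ (SharpInterface.sharpInterface V) u₁) ∧
    (∀ u₁ u₁',
      SharpInterface.IsSplittingStep Ω Wconc ε τ (SharpInterface.sharpInterface V) u₁ →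
      SharpInterface.IsSplittingStep Ω Wconc ε τ (SharpInterface.sharpInterface V) u₁' →
      u₁ =ᵐ[volume.restrict Ω] u₁') ∧
    (∀ u₁,
      SharpInterface.IsSplittingStep Ω Wconc ε τ (SharpInterface.sharpInterface V) u₁ →
      SharpInterface.energy Ω W ε u₁
          ≤ ENNReal.ofReal (√2 + ε / τ) * SharpInterface.perimeter V ∧
      (ε ≤ τ →
        SharpInterface.energy Ω W ε u₁
          ≤ ENNReal.ofReal (√2 + 1) * SharpInterface.perimeter V)) := by
  exact mainTheorem4_general hW hconc hWnonneg hWone hWnegone hΩ hΩvol hV.measurableSet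
    (hVcompact.isBounded.subset subset_closure) hε hτ
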